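/- Let $d\in\{2,3\}$ and $\alpha\in\mathbb R$. Write $\hat f(\xi)=\int_{\mathbb R^d}e^{-i\xi\cdot x}f(x)\,dx$ (extended to $L^2$) and $\|\nabla^{-1}f\|_2=\big(\int_{\mathbb R^d}|\xi|^{-2}|\hat f(\xi)|^2\,d\xi\big)^{1/2}\in[0,\infty]$. Say that $f\in L^2(\mathbb R^d)$ has decay character $r^*>-\frac d2$ if $\lim_{\delta\to0}\delta^{-2r^*-d}\int_{|\xi|\le\delta}|\hat f(\xi)|^2\,d\xi$ exists and lies in $(0,\infty)$. Then there is a rational number $m\ge d+2$, depending only on $d$ and $\alpha$, such that the following holds. Let $1-\frac d2<r^*<1$ and $\alpha>\frac{r^*}{2}+\frac12$. Let $\theta_0\in H^1(\mathbb R^d)$ be real-valued with decay character $r^*$. Let $\nu\ge0$, and let $u$ be a divergence-free vector field on $\mathbb R^d\times(0,\infty)$ with $$\|u(t)\|_2\sim(1+t)^{-\alpha},\qquad \|\nabla u(t)\|_\infty\sim(1+t)^{-\nu}\qquad(t>0),$$ where $a\sim b$ means $c^{-1}b\le a\le c\,b$ with a constant $c\ge1$ independent of $t$. Let $0<\kappa\le\kappa_{\max}$,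 and let $\theta\in C([0,\infty);L^2)\cap L^2_{\rm loc}([0,\infty);H^1)$ be a weak solution of $\partial_t\theta+u\cdot\nabla\theta-\kappa\Delta\theta=0$, $\theta(0)=\theta_0$. Let $t>0$ be so large that $$(1+t)^{r^*-1}\le\kappa^{m+\frac12-\frac d4-r^*}\ \text{ if }\alpha\ge\tfrac32-\tfrac{r^*}2,\qquad (1+t)^{\frac{r^*}2-\alpha+\frac12}\le\kappa^{m+\frac12-\frac d4-r^*}\ \text{ if }\tfrac{r^*}{2}+\tfrac12<\alpha\le\tfrac32-\tfrac{r^*}2 .$$ Then, with a constant $C>0$, $$\|\nabla^{-1}\theta(t)\|_2\ \ge\ C\,\kappa^{-\frac d2-r^*+m+\frac12}\times\begin{cases} e^{-\frac{(1+t)^{1-\nu}-1}{1-\nu}}\,(1+t)^{-\frac d4-\frac{r^*}2+\frac12}, & \nu>1,\\[2pt] (1+t)^{-\frac d4-\frac{r^*}2+\frac12}, & \nu=1,\\[2pt] e^{-\frac{(1+t)^{1-\nu}-1}{1-\nu}}\,(1+t)^{-\frac d4-\frac{r^*}2+\frac32}, & 0\le\nu<1.\end{cases}$$ The constant $C$ depends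 only on $d$, $\alpha$, $r^*$, $\|\theta_0\|_2$, $\|\nabla\theta_0\|_2$, $c$, $\kappa_{\max}$, and on numbers $p,\rho>0$ with $p^{-1}\delta^{2r^*+d}\le\int_{|\xi|\le\delta}|\hat\theta_0|^2\,d\xi\le p\,\delta^{2r^*+d}$ for $0<\delta\le\rho$ (such numbers exist by the definition of the decay character); it does not depend on $\kappa$, $\nu$, $t$, nor otherwise on $\theta_0$ and $u$. -/

import Mathlib

open MeasureTheory Set Filter Topology
open scoped ENNReal ContDiff

noncomputable section

namespace AdvectionDiffusion

/-- The space `ℝ^d` with its Euclidean norm. -/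
abbrev Space (d : ℕ) : Type := EuclideanSpace ℝ (Fin d)

/-- `L²(ℝ^d; F)`. -/
abbrev L2 (d : ℕ) (F : Type) [NormedAddCommGroup F] : Type :=
  Lp (α := Space d) F 2 (volume : Measure (Space d))

/-! ### Fourier transform, decay character, inverse gradient -/

/-- A real-valued `L²` function regarded as a complex-valued one. -/
def complexify {d : ℕ} (f : L2 d ℝ) : L2 d ℂ :=
  Complex.ofRealCLM.compLp f

/-- The (Plancherel) Fourier transform of `f ∈ L²(ℝ^d)` in the normalization
`f̂(ξ) = ∫ e^{-i ξ·x} f(x) dx`. Mathlib's transform uses the phase `e^{-2π i ξ·x}`, hence the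
dilation by `(2π)⁻¹`. -/
def fourierHat {d : ℕ} (f : L2 d ℝ) (ξ : Space d) : ℂ :=
  (FourierTransform.fourier (complexify f) : L2 d ℂ) ((2 * Real.pi)⁻¹ • ξ)

/-- The low-frequency energy `∫_{|ξ| ≤ δ} |f̂(ξ)|² dξ`. -/
def lowFreqEnergy {d : ℕ} (f : L2 d ℝ) (δ : ℝ) : ℝ :=
  ∫ ξ in Metric.closedBall (0 : Space d) δ, ‖fourierHat f ξ‖ ^ 2

/-- `f` has decay character `r`: `r > -d/2`, and the limit of
`δ^{-2r-d} ∫_{|ξ| ≤ δ} |f̂(ξ)|² dξ` as `δ ↓ 0` exists and is positive and finite.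
(At most one `r` has this property.) -/
def HasDecayCharacter {d : ℕ} (f : L2 d ℝ) (r : ℝ) : Prop :=
  -(d : ℝ) / 2 < r ∧
    ∃ P : ℝ, 0 < P ∧
      Tendsto (fun δ : ℝ => δ ^ (-2 * r - (d : ℝ)) * lowFreqEnergy f δ) (𝓝[>] 0) (𝓝 P)

/-- Quantitative form of the two-sided bound behind the decay character:
`p⁻¹ δ^{2r+d} ≤ ∫_{|ξ| ≤ δ} |f̂(ξ)|² dξ ≤ p δ^{2r+d}` for all `0 < δ ≤ ρ`. Every `f` with decay
character `r` has this property for some `p, ρ > 0`; the pair `(p, ρ)` is only used to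
say on which features of the initial datum a constant depends. -/
def LowFreqBounds {d : ℕ} (f : L2 d ℝ) (r p ρ : ℝ) : Prop :=
  ∀ δ : ℝ, 0 < δ → δ ≤ ρ →
    p⁻¹ * δ ^ (2 * r + (d : ℝ)) ≤ lowFreqEnergy f δ ∧
      lowFreqEnergy f δ ≤ p * δ ^ (2 * r + (d : ℝ))

/-- `‖∇⁻¹ f‖₂ = (∫ (|ξ|⁻¹ |f̂(ξ)|)² dξ)^{1/2}`, with values in `[0, ∞]`. -/
def invGradNorm {d : ℕ} (f : L2 d ℝ) : ℝ≥0∞ :=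
  eLpNorm (fun ξ : Space d => ‖ξ‖⁻¹ * ‖fourierHat f ξ‖) 2 volume

/-! ### Weak derivatives and the equation -/

/-- Test functions: `C_c^∞(ℝ^d)`. -/
def IsTestFunction {d : ℕ} (φ : Space d → ℝ) : Prop :=
  ContDiff ℝ ∞ φ ∧ HasCompactSupport φ

/-- The locally integrable field `G` of linear maps is the weak (distributional) gradient of the
locally integrable function `f`. -/
def HasWeakGradient {d : ℕ} {F : Type} [NormedAddCommGroup F] [NormedSpace ℝ F]
    (f : Space d → F) (G : Space d → (Space d →L[ℝ] F)) : Prop :=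
  LocallyIntegrable f volume ∧ LocallyIntegrable G volume ∧
    ∀ φ : Space d → ℝ, IsTestFunction φ → ∀ v : Space d,
      ∫ x, (fderiv ℝ φ x v) • f x = -∫ x, φ x • G x v

/-- `∇ · w = 0` in the sense of distributions. -/
def IsDivergenceFree {d : ℕ} (w : L2 d (Space d)) : Prop :=
  ∀ φ : Space d → ℝ, IsTestFunction φ → ∫ x, fderiv ℝ φ x (w x) = 0

/-- `u` is an admissible velocity field on `(0, ∞)`: measurable in time with values in `L²`,
divergence-free, with `‖u(t)‖₂ ∼ (1+t)^{-α}` and `‖∇u(t)‖_∞ ∼ (1+t)^{-ν}` for all `t > 0`, where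
`∼` is equality up to a factor in `[c⁻¹, c]`. -/
structure IsAdmissibleVelocity {d : ℕ} (α ν c : ℝ) (u : ℝ → L2 d (Space d)) : Prop where
  measurable : AEStronglyMeasurable u (volume.restrict (Ioi (0 : ℝ)))
  divergence_free : ∀ t : ℝ, 0 < t → IsDivergenceFree (u t)
  norm_bounds : ∀ t : ℝ, 0 < t →
    c⁻¹ * (1 + t) ^ (-α) ≤ ‖u t‖ ∧ ‖u t‖ ≤ c * (1 + t) ^ (-α)
  gradient_bounds : ∀ t : ℝ, 0 < t →
    ∃ G : Space d → (Space d →L[ℝ] Space d), HasWeakGradient (u t) G ∧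
      ENNReal.ofReal (c⁻¹ * (1 + t) ^ (-ν)) ≤ eLpNorm G ∞ volume ∧
      eLpNorm G ∞ volume ≤ ENNReal.ofReal (c * (1 + t) ^ (-ν))

/-- `θ` is a weak solution, in the energy space `C([0,∞); L²) ∩ L²_loc([0,∞); H¹)`, of
`∂_t θ + u · ∇θ - κ Δθ = 0`, `θ(0) = θ₀`, for a divergence-free velocity field `u`. The equation is
tested against `φ ∈ C_c^∞(ℝ^d)` and integrated over `(0, t)`; since `∇ · u = 0`, the advection
term is written as `∇ · (u θ)`. -/
structure IsSolution {d : ℕ} (κ : ℝ) (u : ℝ → L2 d (Space d)) (θ₀ : L2 d ℝ)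
    (θ : ℝ → L2 d ℝ) : Prop where
  continuous : ContinuousOn θ (Ici (0 : ℝ))
  initial : θ 0 = θ₀
  gradient : ∃ g : ℝ → L2 d (Space d →L[ℝ] ℝ),
    (∀ T : ℝ, 0 < T → MemLp g 2 (volume.restrict (Ioc 0 T))) ∧
      ∀ᵐ t ∂(volume.restrict (Ioi (0 : ℝ))), HasWeakGradient (θ t) (g t)
  equation : ∀ φ : Space d → ℝ, IsTestFunction φ → ∀ t : ℝ, 0 < t →
    (∫ x, θ t x * φ x) - (∫ x, θ₀ x * φ x) =
      ∫ s in (0 : ℝ)..t, ∫ x, θ s x * (fderiv ℝ φ x (u s x) + κ * Laplacian.laplacian φ x)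

/-- The time `t` is sufficiently large in terms of `κ`:
`(1+t)^{r-1} ≤ κ^{m+1/2-d/4-r}` if `α ≥ 3/2 - r/2`, and
`(1+t)^{r/2-α+1/2} ≤ κ^{m+1/2-d/4-r}` if `α ≤ 3/2 - r/2`. -/
def IsLargeTime (d : ℕ) (r α m κ t : ℝ) : Prop :=
  (3 / 2 - r / 2 ≤ α →
    (1 + t) ^ (r - 1) ≤ κ ^ (m + 1 / 2 - (d : ℝ) / 4 - r)) ∧
  (α ≤ 3 / 2 - r / 2 →
    (1 + t) ^ (r / 2 - α + 1 / 2) ≤ κ ^ (m + 1 / 2 - (d : ℝ) / 4 - r))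

end AdvectionDiffusion

end

/-!
Write `Θ(s)` for the Fourier transform of `θ(s)` and `W(s) = m Θ(s)`, where `m` is a smooth bump
function that equals one for `|ξ| ≤ δ` and vanishes for `|ξ| > 2δ` (these frequencies refer to the
phase `e^{-iξ·x}`; in Mathlib's normalization both radii are divided by `2π`). The lower bound comes
from the fact that the frequencies of size `δ ∼ (1+t)^{-1/2}` hardly change up to time `t`, so that
they keep the mass `∼ δ^{2r+d}` which the decay character gives to the initial datum; dividing by
`|ξ| ≲ δ` yields `‖∇⁻¹ θ(t)‖₂ ≳ δ^{r+d/2-1}` (`ofReal_norm_mulOp_le_invGradNorm`,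
`lowFreqEnergy_le`).

The change of `W` is controlled by Duhamel's formula. Testing the weak formulation with `Re 𝓕⁻¹(m
g)` and using density, one gets `W(t) - W(0) = ∫₀ᵗ F(s) ds` weakly in `L²`
(`inner_mulOp_sub_eq_integral`), where `F` consists of a diffusive part of size `κ δ² ‖W(s)‖₂` and
an advective part of size `δ^{1+d/2} ‖θ(s)‖₂ ‖u(s)‖₂ ≲ δ^{1+d/2} ‖θ₀‖₂ (1+s)^{-α}`
(`norm_bandForce_le`). With `δ = ε (1+t)^{-1/2}` the former integrates to at most a small multiple
of `sup ‖W‖₂`. As `α > β = (r+1)/2` and `β < 1`, the latter integrates to `≲ δ^{1+d/2} (1+t)^{1-β} =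
ε^{1-r} δ^{r+d/2}`, a small multiple of `‖W(0)‖₂` (`two_mul_norm_mulOp_le`,
`ofReal_le_invGradNorm_of_scale`).

The estimate of the advective part uses `‖θ(s)‖₂ ≤ ‖θ₀‖₂` (`IsSolution.norm_le`). A weak solution is
not an admissible test function, so this is derived for the truncations `m Θ` with `m → 1`. For
these the chain rule for `‖m Θ‖₂²` holds in integrated form (`norm_sq_sub_norm_sq_eq_integral`), the
diffusion has a sign, and since `u` is divergence-free the advection contributes at most `‖u‖_∞
‖∇θ‖₂ ‖(1 - m²) Θ‖₂` (`bandForce_self_le`), which is integrable in time and tends to zero. The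
velocity is bounded because it lies in `L²` and has a bounded gradient
(`IsAdmissibleVelocity.exists_ae_norm_le`).

The resulting rate `(1+t)^{1/2-d/4-r/2}` is uniform in `0 < κ ≤ κmax`
(`exists_ofReal_le_invGradNorm`) and implies all three cases with the exponent `d + 2` as the
rational number: the power of `κ` is nonnegative, hence bounded; for `ν > 1` the exponential is at
most one, and for `ν < 1` it absorbs the additional factor `1 + t` (`exp_mul_one_add_le_one`).
-/

open scoped SchwartzMap FourierTransform

noncomputable section

namespace AdvectionDiffusion

variable {d : ℕ}

/-! ### Density of test functions -/

/-- Compactly supported functions are dense in the Schwartz space: the truncations `χ(x/n) φ`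
converge to `φ` in every Schwartz seminorm. -/
theorem dense_hasCompactSupport_schwartz {d : ℕ} :
    Dense {φ : 𝓢(Space d, ℝ) | HasCompactSupport φ} := by
  intro φ
  let χ : ContDiffBump (0 : Space d) := ⟨1, 2, one_pos, one_lt_two⟩
  let s : ℕ → Space d →L[ℝ] Space d := fun n => ((n : ℝ) + 1)⁻¹ • ContinuousLinearMap.id ℝ _
  have hs : ∀ n, ‖s n‖ ≤ 1 := fun n => by
    refine (norm_smul_le (((n : ℝ) + 1)⁻¹) (ContinuousLinearMap.id ℝ (Space d))).trans ?_
    have h1 : ‖((n : ℝ) + 1)⁻¹‖ ≤ 1 := by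
      rw [norm_inv, Real.norm_of_nonneg (by positivity)]
      exact inv_le_one_of_one_le₀ (by linarith [n.cast_nonneg (α := ℝ)])
    exact mul_le_one₀ h1 (norm_nonneg _) ContinuousLinearMap.norm_id_le
  have hχt : Function.HasTemperateGrowth (χ : Space d → ℝ) :=
    χ.hasCompactSupport.hasTemperateGrowth χ.contDiff
  let η : Space d → ℝ := fun x => 1 - χ x
  have hηc : ContDiff ℝ (⊤ : ℕ∞) η := contDiff_const.sub χ.contDiff
  have hηt : Function.HasTemperateGrowth η :=
    (Function.HasTemperateGrowth.const (1 : ℝ)).sub hχt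
  have hχn : ∀ n, Function.HasTemperateGrowth (fun x => χ (s n x)) := fun n =>
    hχt.comp (s n).hasTemperateGrowth
  let ψ : ℕ → 𝓢(Space d, ℝ) := fun n => SchwartzMap.smulLeftCLM ℝ (fun x => χ (s n x)) φ
  have hψ : ∀ n x, ψ n x = χ (s n x) • φ x := fun n x =>
    SchwartzMap.smulLeftCLM_apply_apply (hχn n) φ x
  have hcs : ∀ n, HasCompactSupport (ψ n) := by
    intro n
    refine HasCompactSupport.intro
      (isCompact_closedBall (0 : Space d) (2 * ((n : ℝ) + 1))) fun x hx => ?_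
    rw [hψ, χ.zero_of_le_dist, zero_smul]
    have hx' : 2 * ((n : ℝ) + 1) < ‖x‖ := by simpa using hx
    have : ‖s n x‖ = ((n : ℝ) + 1)⁻¹ * ‖x‖ := by
      simp only [s, smul_apply, ContinuousLinearMap.id_apply, norm_smul,
        norm_inv]
      rw [Real.norm_of_nonneg (by positivity)]
    rw [dist_zero_right, this]
    have hn : (0 : ℝ) < n + 1 := by positivity
    rw [inv_mul_eq_div, le_div_iff₀ hn]
    exact hx'.le
  refine mem_closure_of_tendsto (f := ψ) (b := atTop) ?_ (Eventually.of_forall hcs)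
  rw [(schwartz_withSeminorms ℝ (Space d) ℝ).tendsto_nhds ψ φ]
  rintro ⟨k, l⟩ ε hε
  obtain ⟨k', C, hC, hη⟩ :=
    hηt.norm_iteratedFDeriv_le_uniform l
  let B : ℝ := 2 ^ (k + k' + 1) *
    (Finset.Iic (k + k' + 1, l)).sup (fun m => SchwartzMap.seminorm ℝ m.1 m.2) φ
  have hB : ∀ i ≤ l, ∀ x, (1 + ‖x‖) ^ (k + k' + 1) * ‖iteratedFDeriv ℝ i φ x‖ ≤ B :=
    fun i hi x => SchwartzMap.one_add_le_sup_seminorm_apply (𝕜 := ℝ)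
      (m := (k + k' + 1, l)) le_rfl hi φ x
  have hB0 : 0 ≤ B := le_trans (by positivity) (hB 0 (Nat.zero_le _) 0)
  have key : ∀ n : ℕ, SchwartzMap.seminorm ℝ k l (ψ n - φ) ≤ (2 ^ l * C * B) / ((n : ℝ) + 1) := by
    intro n
    have hn : (0 : ℝ) < n + 1 := by positivity
    refine SchwartzMap.seminorm_le_bound ℝ k l _ (by positivity) fun x => ?_
    have hfun : ((ψ n - φ : 𝓢(Space d, ℝ)) : Space d → ℝ)
        = fun y => -((η ∘ s n) y • φ y) := by
      ext y
      simp only [sub_apply, hψ, Function.comp, η, smul_eq_mul]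
      ring
    rw [hfun]
    rcases lt_or_ge ‖x‖ (n + 1) with hx | hx
    · have hz : (fun y => -((η ∘ s n) y • φ y)) =ᶠ[𝓝 x]
          fun _ => (0 : ℝ) := by
        have : Metric.ball (0 : Space d) (n + 1) ∈ 𝓝 x :=
          Metric.isOpen_ball.mem_nhds (by simpa using hx)
        filter_upwards [this] with y hy
        have hy' : ‖y‖ < n + 1 := by simpa using hy
        have h1 : χ (s n y) = 1 := by
          apply χ.one_of_mem_closedBall
          have : ‖s n y‖ = ((n : ℝ) + 1)⁻¹ * ‖y‖ := by
            simp only [s, smul_apply, ContinuousLinearMap.id_apply, norm_smul,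
              norm_inv]
            rw [Real.norm_of_nonneg (by positivity)]
          rw [mem_closedBall_zero_iff, this, inv_mul_eq_div, div_le_iff₀ hn]
          change ‖y‖ ≤ 1 * _
          linarith
        simp [h1, η]
      rw [(hz.iteratedFDeriv ℝ l).eq_of_nhds]
      have : iteratedFDeriv ℝ l (fun _ : Space d => (0 : ℝ)) x = 0 := by
        rw [iteratedFDeriv_fun_zero]; rfl
      rw [this]
      simp only [norm_zero, mul_zero]
      positivity
    · have hcd : ContDiff ℝ (⊤ : ℕ∞) (η ∘ s n) :=
        hηc.comp (s n).contDiff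
      have e1 : iteratedFDeriv ℝ l
          (fun y => -((η ∘ s n) y • φ y)) x
          = - iteratedFDeriv ℝ l
            (fun y => ((η ∘ s n) y • φ y)) x :=
        iteratedFDeriv_neg_apply
      rw [e1, norm_neg]
      have hLeib := norm_iteratedFDeriv_smul_le (𝕜 := ℝ) hcd (φ.smooth ⊤) x (n := l)
        (by exact_mod_cast le_top)
      have hterm : ∀ i ∈ Finset.range (l + 1),
          (l.choose i : ℝ) * ‖iteratedFDeriv ℝ i (η ∘ s n) x‖
            * ‖iteratedFDeriv ℝ (l - i) φ x‖
          ≤ (l.choose i : ℝ) * (C * (1 + ‖x‖) ^ k' * ‖iteratedFDeriv ℝ (l - i) φ x‖) := by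
        intro i hi
        have hi' : i ≤ l := Nat.lt_succ_iff.mp (Finset.mem_range.mp hi)
        have h1 : ‖iteratedFDeriv ℝ i (η ∘ s n) x‖
            ≤ C * (1 + ‖x‖) ^ k' := by
          rw [(s n).iteratedFDeriv_comp_right hηc x (i := i) (by exact_mod_cast le_top)]
          refine (ContinuousMultilinearMap.norm_compContinuousLinearMap_le _ _).trans ?_
          rw [Finset.prod_const, Finset.card_univ, Fintype.card_fin]
          have h2 : ‖s n‖ ^ i ≤ 1 := pow_le_one₀ (norm_nonneg _) (hs n)
          have h3 : ‖s n x‖ ≤ ‖x‖ := by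
            simpa using (s n).le_of_opNorm_le (hs n) x
          calc _ ≤ C * (1 + ‖s n x‖) ^ k' * 1 := by
                gcongr
                exact hη i hi' (s n x)
            _ ≤ _ := by rw [mul_one]; gcongr
        rw [mul_assoc]
        gcongr
      calc ‖x‖ ^ k * _ ≤ (1 + ‖x‖) ^ k * ∑ i ∈ Finset.range (l + 1),
            (l.choose i : ℝ) * (C * (1 + ‖x‖) ^ k' * ‖iteratedFDeriv ℝ (l - i) φ x‖) := by
            refine mul_le_mul ?_ (hLeib.trans (Finset.sum_le_sum hterm)) (norm_nonneg _)
              (by positivity)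
            gcongr
            linarith
        _ = ∑ i ∈ Finset.range (l + 1), (l.choose i : ℝ) *
            (C * ((1 + ‖x‖) ^ (k + k' + 1) * ‖iteratedFDeriv ℝ (l - i) φ x‖) / (1 + ‖x‖)) := by
            rw [Finset.mul_sum]
            refine Finset.sum_congr rfl fun i _ => ?_
            have : (1 + ‖x‖) ≠ 0 := by positivity
            field_simp
            ring
        _ ≤ ∑ i ∈ Finset.range (l + 1), (l.choose i : ℝ) * (C * B / (n + 1)) := by
            refine Finset.sum_le_sum fun i _ => ?_
            have h5 := hB (l - i) (Nat.sub_le _ _) x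
            have h6 : (n : ℝ) + 1 ≤ 1 + ‖x‖ := by linarith
            exact mul_le_mul_of_nonneg_left (div_le_div₀ (by positivity) (by gcongr) hn h6)
              (by positivity)
        _ = _ := by
            rw [← Finset.sum_mul]
            have := Nat.sum_range_choose l
            have h6 : ∑ i ∈ Finset.range (l + 1), (l.choose i : ℝ) = 2 ^ l := by
              exact_mod_cast this
            rw [h6]; ring
  have hlim : Tendsto (fun n : ℕ => (2 ^ l * C * B) / ((n : ℝ) + 1)) atTop (𝓝 0) :=
    tendsto_const_nhds.div_atTop
      (tendsto_atTop_add_const_right _ _ tendsto_natCast_atTop_atTop)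
  filter_upwards [hlim.eventually_lt_const hε] with n hn
  exact (key n).trans_lt hn

/-- A tempered distribution that vanishes on test functions vanishes. -/
theorem eq_zero_of_isTestFunction {d : ℕ} (Λ : 𝓢(Space d, ℝ) →L[ℝ] ℝ)
    (h : ∀ φ : 𝓢(Space d, ℝ), IsTestFunction φ → Λ φ = 0) (φ : 𝓢(Space d, ℝ)) : Λ φ = 0 := by
  have hcl : IsClosed {φ : 𝓢(Space d, ℝ) | Λ φ = 0} := isClosed_eq Λ.continuous continuous_const
  have : closure {φ : 𝓢(Space d, ℝ) | HasCompactSupport φ} ⊆ {φ | Λ φ = 0} :=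
    hcl.closure_subset_iff.mpr fun φ hφ => h φ ⟨φ.smooth ⊤, hφ⟩
  exact this (dense_hasCompactSupport_schwartz φ)

/-! ### Pairings with Schwartz functions -/

theorem inner_toLp_eq_integral (f : L2 d ℝ) (φ : 𝓢(Space d, ℝ)) :
    inner ℝ f (φ.toLp 2) = ∫ x, f x * φ x := by
  rw [L2.inner_def]
  refine integral_congr_ae ?_
  filter_upwards [φ.coeFn_toLp 2 volume] with x hx
  rw [hx]
  simp [mul_comm]

/-- The pairing `∫ L(x) q(x) dx` of an integrable vector field with a bounded covector field. -/
def covectorPairing (d : ℕ) :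
    Lp (α := Space d) (Space d) 1 volume →L[ℝ]
      Lp (α := Space d) (Space d →L[ℝ] ℝ) ∞ volume →L[ℝ] ℝ :=
  (ContinuousLinearMap.apply ℝ ℝ : Space d →L[ℝ] (Space d →L[ℝ] ℝ) →L[ℝ] ℝ).lpPairing volume 1 ∞

/-- The differential of a Schwartz function as an essentially bounded covector field. -/
def gradTop (d : ℕ) : 𝓢(Space d, ℝ) →L[ℝ] Lp (α := Space d) (Space d →L[ℝ] ℝ) ∞ volume :=
  SchwartzMap.toLpCLM ℝ (Space d →L[ℝ] ℝ) ∞ volume ∘L SchwartzMap.fderivCLM ℝ (Space d) ℝ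

theorem coeFn_gradTop (φ : 𝓢(Space d, ℝ)) : gradTop d φ =ᵐ[volume] fderiv ℝ φ :=
  (SchwartzMap.fderivCLM ℝ (Space d) ℝ φ).coeFn_toLp ∞ volume

theorem covectorPairing_gradTop (q : Lp (α := Space d) (Space d) 1 volume) (φ : 𝓢(Space d, ℝ)) :
    covectorPairing d q (gradTop d φ) = ∫ x, fderiv ℝ φ x (q x) := by
  rw [covectorPairing, ContinuousLinearMap.lpPairing_eq_integral]
  refine integral_congr_ae ?_
  filter_upwards [coeFn_gradTop φ] with x hx
  rw [hx]
  rfl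

/-- The flux `f w` of a scalar by a velocity, as an integrable vector field. -/
def flux : L2 d ℝ →L[ℝ] L2 d (Space d) →L[ℝ] Lp (α := Space d) (Space d) 1 volume :=
  (ContinuousLinearMap.lsmul ℝ ℝ).holderL volume 2 2 1

theorem coeFn_flux (f : L2 d ℝ) (w : L2 d (Space d)) :
    flux f w =ᵐ[volume] fun x => f x • w x :=
  ContinuousLinearMap.coeFn_holder _ f w

theorem norm_flux_le (f : L2 d ℝ) (w : L2 d (Space d)) : ‖flux f w‖ ≤ ‖f‖ * ‖w‖ := by
  refine (ContinuousLinearMap.norm_holder_apply_apply_le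
    (ContinuousLinearMap.lsmul ℝ ℝ : ℝ →L[ℝ] Space d →L[ℝ] Space d) f w).trans ?_
  have : ‖(ContinuousLinearMap.lsmul ℝ ℝ : ℝ →L[ℝ] Space d →L[ℝ] Space d)‖ ≤ 1 :=
    ContinuousLinearMap.opNorm_lsmul_le
  rw [mul_assoc]
  exact mul_le_of_le_one_left (by positivity) this

/-- A drift-diffusion identity that holds against test functions holds against Schwartz
functions. -/
theorem inner_schwartz_of_test (f z : L2 d ℝ) (q : Lp (α := Space d) (Space d) 1 volume)
    (h : ∀ φ : Space d → ℝ, IsTestFunction φ →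
      ∫ x, f x * φ x = (∫ x, fderiv ℝ φ x (q x)) + ∫ x, z x * Laplacian.laplacian φ x)
    (φ : 𝓢(Space d, ℝ)) :
    inner ℝ f (φ.toLp 2) = covectorPairing d q (gradTop d φ)
      + inner ℝ z ((Laplacian.laplacian φ : 𝓢(Space d, ℝ)).toLp 2) := by
  let Λ : 𝓢(Space d, ℝ) →L[ℝ] ℝ :=
    innerSL ℝ f ∘L SchwartzMap.toLpCLM ℝ ℝ 2 volume - covectorPairing d q ∘L gradTop d
      - innerSL ℝ z ∘L SchwartzMap.toLpCLM ℝ ℝ 2 volume ∘L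
        LineDeriv.laplacianCLM ℝ (Space d) 𝓢(Space d, ℝ)
  have hΛ : ∀ φ, Λ φ = inner ℝ f (φ.toLp 2) - covectorPairing d q (gradTop d φ)
      - inner ℝ z ((Laplacian.laplacian φ : 𝓢(Space d, ℝ)).toLp 2) := fun φ => rfl
  have := eq_zero_of_isTestFunction Λ (fun φ hφ => by
    rw [hΛ, inner_toLp_eq_integral, inner_toLp_eq_integral, covectorPairing_gradTop, h φ hφ]
    simp only [SchwartzMap.laplacian_apply]
    ring) φ
  rw [hΛ] at this
  linarith

/-- The identity defining the weak gradient of an `L²` function holds against Schwartz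
functions. -/
theorem inner_lineDeriv_of_hasWeakGradient {f : L2 d ℝ} {G : L2 d (Space d →L[ℝ] ℝ)}
    (h : HasWeakGradient f G) (v : Space d) (φ : 𝓢(Space d, ℝ)) :
    inner ℝ f ((LineDeriv.lineDerivOp v φ : 𝓢(Space d, ℝ)).toLp 2)
      = -inner ℝ ((ContinuousLinearMap.apply ℝ ℝ v).compLp G : L2 d ℝ) (φ.toLp 2) := by
  let Gv : L2 d ℝ := (ContinuousLinearMap.apply ℝ ℝ v).compLp G
  have hGv : Gv =ᵐ[volume] fun x => G x v := ContinuousLinearMap.coeFn_compLp _ G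
  let Λ : 𝓢(Space d, ℝ) →L[ℝ] ℝ :=
    innerSL ℝ f ∘L SchwartzMap.toLpCLM ℝ ℝ 2 volume ∘L
        LineDeriv.lineDerivOpCLM ℝ 𝓢(Space d, ℝ) v
      + innerSL ℝ Gv ∘L SchwartzMap.toLpCLM ℝ ℝ 2 volume
  have hΛ : ∀ φ, Λ φ = inner ℝ f ((LineDeriv.lineDerivOp v φ : 𝓢(Space d, ℝ)).toLp 2)
      + inner ℝ Gv (φ.toLp 2) := fun φ => rfl
  have := eq_zero_of_isTestFunction Λ (fun φ hφ => by
    rw [hΛ, inner_toLp_eq_integral, inner_toLp_eq_integral]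
    have h1 := h.2.2 φ hφ v
    have h2 : ∫ x, f x * (LineDeriv.lineDerivOp v φ : 𝓢(Space d, ℝ)) x
        = ∫ x, fderiv ℝ φ x v • f x := by
      refine integral_congr_ae (Eventually.of_forall fun x => ?_)
      simp only [SchwartzMap.lineDerivOp_apply_eq_fderiv, smul_eq_mul, mul_comm]
    have h3 : ∫ x, Gv x * φ x = ∫ x, φ x • G x v := by
      refine integral_congr_ae ?_
      filter_upwards [hGv] with x hx
      rw [hx, smul_eq_mul, mul_comm]
    rw [h2, h3, h1]
    ring) φ
  rw [hΛ] at this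
  linarith

theorem integral_fderiv_of_isDivergenceFree {w : L2 d (Space d)} (h : IsDivergenceFree w)
    (φ : 𝓢(Space d, ℝ)) : ∫ x, fderiv ℝ φ x (w x) = 0 := by
  let P := (ContinuousLinearMap.apply ℝ ℝ :
    Space d →L[ℝ] (Space d →L[ℝ] ℝ) →L[ℝ] ℝ).lpPairing (volume : Measure (Space d)) 2 2
  let Λ : 𝓢(Space d, ℝ) →L[ℝ] ℝ :=
    P w ∘L SchwartzMap.toLpCLM ℝ (Space d →L[ℝ] ℝ) 2 volume ∘L
      SchwartzMap.fderivCLM ℝ (Space d) ℝ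
  have hΛ : ∀ φ, Λ φ = ∫ x, fderiv ℝ φ x (w x) := fun φ => by
    change P w ((SchwartzMap.fderivCLM ℝ (Space d) ℝ φ).toLp 2) = _
    rw [ContinuousLinearMap.lpPairing_eq_integral]
    refine integral_congr_ae ?_
    filter_upwards [(SchwartzMap.fderivCLM ℝ (Space d) ℝ φ).coeFn_toLp 2 volume] with x hx
    rw [hx]
    rfl
  rw [← hΛ]
  exact eq_zero_of_isTestFunction Λ (fun φ hφ => by rw [hΛ]; exact h φ hφ) φ

/-! ### Fourier multipliers with real Schwartz symbols -/

/-- The pointwise product of a real symbol and a complex Schwartz function. -/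
abbrev symbolMul (a : 𝓢(Space d, ℝ)) (g : 𝓢(Space d, ℂ)) : 𝓢(Space d, ℂ) :=
  SchwartzMap.smulLeftCLM ℂ (a : Space d → ℝ) g

theorem symbolMul_apply (a : 𝓢(Space d, ℝ)) (g : 𝓢(Space d, ℂ)) (x : Space d) :
    symbolMul a g x = a x • g x :=
  SchwartzMap.smulLeftCLM_apply_apply a.hasTemperateGrowth g x

/-- Multiplication by a real symbol, as an operator on `L²(ℝ^d; ℂ)`. -/
def mulOp (a : 𝓢(Space d, ℝ)) : L2 d ℂ →L[ℝ] L2 d ℂ :=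
  (ContinuousLinearMap.lsmul ℝ ℝ : ℝ →L[ℝ] ℂ →L[ℝ] ℂ).holderL volume ∞ 2 2 (a.toLp ∞)

theorem coeFn_mulOp (a : 𝓢(Space d, ℝ)) (h : L2 d ℂ) :
    mulOp a h =ᵐ[volume] fun x => a x • h x := by
  filter_upwards [ContinuousLinearMap.coeFn_holder
    (ContinuousLinearMap.lsmul ℝ ℝ : ℝ →L[ℝ] ℂ →L[ℝ] ℂ) (r := 2) (a.toLp ∞) h,
    a.coeFn_toLp ∞ volume] with x h1 h2
  rw [← h2]
  exact h1

theorem norm_mulOp_le (a b : 𝓢(Space d, ℝ)) {C : ℝ} (hab : ∀ x, ‖a x‖ ≤ C * ‖b x‖)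
    (h : L2 d ℂ) : ‖mulOp a h‖ ≤ C * ‖mulOp b h‖ := by
  refine Lp.norm_le_mul_norm_of_ae_le_mul ?_
  filter_upwards [coeFn_mulOp a h, coeFn_mulOp b h] with x h1 h2
  rw [h1, h2, norm_smul, norm_smul, ← mul_assoc]
  gcongr
  exact hab x

theorem norm_mulOp_le_of_bound (a : 𝓢(Space d, ℝ)) {C : ℝ} (ha : ∀ x, ‖a x‖ ≤ C)
    (h : L2 d ℂ) : ‖mulOp a h‖ ≤ C * ‖h‖ := by
  refine Lp.norm_le_mul_norm_of_ae_le_mul ?_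
  filter_upwards [coeFn_mulOp a h] with x h1
  rw [h1, norm_smul]
  gcongr
  exact ha x

theorem mulOp_toLp (a : 𝓢(Space d, ℝ)) (g : 𝓢(Space d, ℂ)) :
    mulOp a (g.toLp 2) = (symbolMul a g).toLp 2 := by
  apply Lp.ext
  filter_upwards [coeFn_mulOp a (g.toLp 2), g.coeFn_toLp 2 volume,
    (symbolMul a g).coeFn_toLp 2 volume] with x h1 h2 h3
  rw [h1, h2, h3, symbolMul_apply]

theorem mulOp_comm (a b : 𝓢(Space d, ℝ)) (h : L2 d ℂ) :
    mulOp a (mulOp b h) = mulOp b (mulOp a h) := by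
  apply Lp.ext
  filter_upwards [coeFn_mulOp a (mulOp b h), coeFn_mulOp b (mulOp a h), coeFn_mulOp a h,
    coeFn_mulOp b h] with x h1 h2 h3 h4
  rw [h1, h2, h3, h4, smul_comm]

theorem inner_mulOp_left (a : 𝓢(Space d, ℝ)) (f g : L2 d ℂ) :
    inner ℝ (mulOp a f) g = inner ℝ f (mulOp a g) := by
  rw [L2.inner_def, L2.inner_def]
  refine integral_congr_ae ?_
  filter_upwards [coeFn_mulOp a f, coeFn_mulOp a g] with x h1 h2
  rw [h1, h2, real_inner_smul_left, real_inner_smul_right]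

/-! ### Band-limited test functions -/

theorem real_inner_eq_re_inner (f g : L2 d ℂ) : inner ℝ f g = (inner ℂ f g).re := by
  rw [L2.inner_def, L2.inner_def, ← RCLike.re_eq_complex_re, ← integral_re]
  · rfl
  · exact L2.integrable_inner f g

theorem real_inner_fourier (f g : L2 d ℂ) :
    inner ℝ (FourierTransform.fourier f : L2 d ℂ) (FourierTransform.fourier g) = inner ℝ f g := by
  rw [real_inner_eq_re_inner, real_inner_eq_re_inner, Lp.inner_fourier_eq]

theorem coeFn_complexify (f : L2 d ℝ) : complexify f =ᵐ[volume] fun x => (f x : ℂ) :=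
  ContinuousLinearMap.coeFn_compLp _ f

/-- The real part of a complex Schwartz function. -/
abbrev reSchwartz (ψ : 𝓢(Space d, ℂ)) : 𝓢(Space d, ℝ) :=
  SchwartzMap.postcompCLM Complex.reCLM ψ

theorem reSchwartz_apply (ψ : 𝓢(Space d, ℂ)) (x : Space d) : reSchwartz ψ x = (ψ x).re := rfl

theorem inner_complexify (f : L2 d ℝ) (ψ : 𝓢(Space d, ℂ)) :
    inner ℝ (complexify f) (ψ.toLp 2) = inner ℝ f ((reSchwartz ψ).toLp 2) := by
  rw [inner_toLp_eq_integral, L2.inner_def]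
  refine integral_congr_ae ?_
  filter_upwards [coeFn_complexify f, ψ.coeFn_toLp 2 volume] with x h1 h2
  rw [h1, h2, reSchwartz_apply]
  simp [Complex.inner, mul_comm]

/-- The real Schwartz function `Re 𝓕⁻¹(m g)`, with frequencies in the support of `m`. -/
def band (m : 𝓢(Space d, ℝ)) (g : 𝓢(Space d, ℂ)) : 𝓢(Space d, ℝ) :=
  reSchwartz (FourierTransformInv.fourierInv (symbolMul m g))

/-- The Fourier transform of a real `L²` function, as a real-linear map into `L²(ℝ^d; ℂ)`. -/
def fourierL2 : L2 d ℝ →L[ℝ] L2 d ℂ :=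
  (FourierTransform.fourierCLM ℂ (L2 d ℂ)).restrictScalars ℝ ∘L
    ContinuousLinearMap.compLpL 2 volume Complex.ofRealCLM

theorem fourierL2_apply (f : L2 d ℝ) :
    fourierL2 f = FourierTransform.fourier (complexify f) := rfl

theorem norm_fourierL2 (f : L2 d ℝ) : ‖fourierL2 f‖ = ‖f‖ := by
  rw [fourierL2_apply, Lp.norm_fourier_eq, Lp.norm_def, Lp.norm_def]
  congr 1
  refine eLpNorm_congr_norm_ae ?_
  filter_upwards [coeFn_complexify f] with x hx
  rw [hx, Complex.norm_real]

/-- Testing against `band m g` amounts to pairing `m f̂` with `g`. -/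
theorem inner_band (m : 𝓢(Space d, ℝ)) (g : 𝓢(Space d, ℂ)) (f : L2 d ℝ) :
    inner ℝ f ((band m g).toLp 2) = inner ℝ (mulOp m (fourierL2 f)) (g.toLp 2) := by
  rw [band, ← inner_complexify, ← real_inner_fourier, SchwartzMap.toLp_fourier_eq,
    FourierTransform.fourier_fourierInv_eq, ← fourierL2_apply, inner_mulOp_left, mulOp_toLp]

/-- The symbol `2π ⟨ξ, v⟩ m(ξ)`. -/
def coordSymbol (m : 𝓢(Space d, ℝ)) (v : Space d) : 𝓢(Space d, ℝ) :=
  (2 * Real.pi) • SchwartzMap.smulLeftCLM ℝ (fun ξ : Space d => inner ℝ ξ v) m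

theorem coordSymbol_apply (m : 𝓢(Space d, ℝ)) (v ξ : Space d) :
    coordSymbol m v ξ = 2 * Real.pi * inner ℝ ξ v * m ξ := by
  have : (fun ξ : Space d => inner ℝ ξ v).HasTemperateGrowth := by fun_prop
  simp [coordSymbol, SchwartzMap.smulLeftCLM_apply_apply this, mul_assoc]

/-- The symbol `4π² |ξ|² m(ξ)`. -/
def laplacianSymbol (m : 𝓢(Space d, ℝ)) : 𝓢(Space d, ℝ) :=
  (2 * Real.pi) ^ 2 • SchwartzMap.smulLeftCLM ℝ (fun ξ : Space d => ‖ξ‖ ^ 2) m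

theorem laplacianSymbol_apply (m : 𝓢(Space d, ℝ)) (ξ : Space d) :
    laplacianSymbol m ξ = (2 * Real.pi) ^ 2 * ‖ξ‖ ^ 2 * m ξ := by
  have : (fun ξ : Space d => ‖ξ‖ ^ 2).HasTemperateGrowth := by fun_prop
  simp [laplacianSymbol, SchwartzMap.smulLeftCLM_apply_apply this, mul_assoc]

theorem fderiv_reSchwartz (ψ : 𝓢(Space d, ℂ)) (x v : Space d) :
    fderiv ℝ (reSchwartz ψ) x v = (fderiv ℝ ψ x v).re := by
  have h : HasFDerivAt (reSchwartz ψ) (Complex.reCLM ∘L fderiv ℝ ψ x) x :=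
    Complex.reCLM.hasFDerivAt.comp x ψ.differentiableAt.hasFDerivAt
  rw [h.fderiv]
  rfl

theorem lineDeriv_band (m : 𝓢(Space d, ℝ)) (g : 𝓢(Space d, ℂ)) (v : Space d) :
    LineDeriv.lineDerivOp v (band m g) = band (coordSymbol m v) (Complex.I • g) := by
  have hv : (fun ξ : Space d => inner ℝ ξ v).HasTemperateGrowth := by fun_prop
  ext x
  rw [SchwartzMap.lineDerivOp_apply_eq_fderiv, band, fderiv_reSchwartz,
    ← SchwartzMap.lineDerivOp_apply_eq_fderiv, SchwartzMap.lineDerivOp_fourierInv_eq, band,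
    reSchwartz_apply]
  congr 3
  ext ξ
  simp only [smul_apply, symbolMul_apply, coordSymbol_apply,
    SchwartzMap.smulLeftCLM_apply_apply hv, Complex.real_smul, smul_eq_mul]
  push_cast
  ring

theorem laplacian_band (m : 𝓢(Space d, ℝ)) (g : 𝓢(Space d, ℂ)) :
    Laplacian.laplacian (band m g) = -band (laplacianSymbol m) g := by
  have hq : (fun ξ : Space d => ‖ξ‖ ^ 2).HasTemperateGrowth := by fun_prop
  rw [SchwartzMap.laplacian_eq_sum (EuclideanSpace.basisFun (Fin d) ℝ)]
  simp only [lineDeriv_band]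
  let Ψ : 𝓢(Space d, ℂ) →+ 𝓢(Space d, ℝ) :=
    (SchwartzMap.postcompCLM (𝕜 := ℝ) Complex.reCLM).toLinearMap.toAddMonoidHom.comp
      (FourierTransform.fourierInvCLM ℂ 𝓢(Space d, ℂ)).toLinearMap.toAddMonoidHom
  have hΨ : ∀ a g, band a g = Ψ (symbolMul a g) := fun a g => rfl
  simp only [hΨ]
  rw [← map_sum, ← map_neg]
  congr 1
  ext ξ
  rw [sum_apply]
  simp only [neg_apply, smul_apply, symbolMul_apply, coordSymbol_apply, laplacianSymbol_apply,
    EuclideanSpace.norm_sq_eq, Real.norm_eq_abs, sq_abs, Complex.real_smul, smul_eq_mul,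
    EuclideanSpace.basisFun_apply,
    EuclideanSpace.inner_single_right]
  rw [Finset.mul_sum, Finset.sum_mul]
  push_cast
  rw [Finset.sum_mul, ← Finset.sum_neg_distrib]
  refine Finset.sum_congr rfl fun i _ => ?_
  have hI : Complex.I * Complex.I = -1 := Complex.I_mul_I
  simp
  linear_combination (2 * (Real.pi : ℂ)) ^ 2 * (ξ i : ℂ) ^ 2 * (m ξ : ℂ) * g ξ * hI

theorem integral_norm_mul_norm_le (m : 𝓢(Space d, ℝ)) (g : 𝓢(Space d, ℂ)) :
    ∫ ξ, ‖m ξ‖ * ‖g ξ‖ ≤ ‖m.toLp 2‖ * ‖g.toLp 2‖ := by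
  rw [SchwartzMap.norm_toLp' (by simp) (by simp), SchwartzMap.norm_toLp' (by simp) (by simp)]
  have h := integral_mul_le_Lp_mul_Lq_of_nonneg (μ := (volume : Measure (Space d)))
    Real.HolderConjugate.two_two (f := fun ξ => ‖m ξ‖) (g := fun ξ => ‖g ξ‖)
    (Eventually.of_forall fun _ => norm_nonneg _) (Eventually.of_forall fun _ => norm_nonneg _)
    (by simpa using (m.memLp 2).norm) (by simpa using (g.memLp 2).norm)
  simpa using h

theorem norm_band_apply_le (m : 𝓢(Space d, ℝ)) (g : 𝓢(Space d, ℂ)) (x : Space d) :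
    ‖band m g x‖ ≤ ∫ ξ, ‖m ξ‖ * ‖g ξ‖ := by
  rw [band, reSchwartz_apply]
  refine (Complex.abs_re_le_norm _).trans ?_
  rw [SchwartzMap.fourierInv_coe, Real.fourierInv_eq_fourier_neg, ← SchwartzMap.fourier_coe]
  refine (SchwartzMap.norm_fourier_apply_le_toLp_one _ _).trans ?_
  rw [SchwartzMap.norm_toLp_one]
  refine le_of_eq (integral_congr_ae (Eventually.of_forall fun ξ => ?_))
  simp only [symbolMul_apply, norm_smul]

/-- Bernstein's inequality: a function with frequencies in the ball of radius `R` has its gradient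
bounded by `R` times the `L¹` norm of its Fourier transform. -/
theorem norm_fderiv_band_le {m : 𝓢(Space d, ℝ)} {R : ℝ} (hm : ∀ ξ, m ξ ≠ 0 → ‖ξ‖ ≤ R)
    (hR : 0 ≤ R) (g : 𝓢(Space d, ℂ)) (x : Space d) :
    ‖fderiv ℝ (band m g) x‖ ≤ 2 * Real.pi * R * ‖m.toLp 2‖ * ‖g.toLp 2‖ := by
  have hpi := Real.pi_pos
  refine ContinuousLinearMap.opNorm_le_bound _ (by positivity) fun v => ?_
  rw [← SchwartzMap.lineDerivOp_apply_eq_fderiv, lineDeriv_band]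
  refine (norm_band_apply_le _ _ _).trans ?_
  have hint : Integrable (fun ξ => ‖m ξ‖ * ‖g ξ‖) := by
    have := (symbolMul m g).integrable (μ := volume).norm
    refine this.congr (Eventually.of_forall fun ξ => ?_)
    simp only [symbolMul_apply, norm_smul]
  calc ∫ ξ, ‖coordSymbol m v ξ‖ * ‖(Complex.I • g) ξ‖
      ≤ ∫ ξ, (2 * Real.pi * R * ‖v‖) * (‖m ξ‖ * ‖g ξ‖) := by
        refine integral_mono_of_nonneg (Eventually.of_forall fun ξ => by positivity)
          (hint.const_mul _) (Eventually.of_forall fun ξ => ?_)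
        simp only [smul_apply, norm_smul, Complex.norm_I, one_mul, coordSymbol_apply, norm_mul]
        rw [← mul_assoc]
        refine mul_le_mul_of_nonneg_right ?_ (norm_nonneg _)
        by_cases h0 : m ξ = 0
        · simp [h0]
        · refine mul_le_mul_of_nonneg_right ?_ (norm_nonneg _)
          have h1 : ‖(inner ℝ ξ v : ℝ)‖ ≤ R * ‖v‖ :=
            (norm_inner_le_norm ξ v).trans (by gcongr; exact hm ξ h0)
          rw [Real.norm_of_nonneg Real.pi_pos.le, Real.norm_two, mul_assoc (2 * Real.pi)]
          gcongr
    _ = (2 * Real.pi * R * ‖v‖) * ∫ ξ, ‖m ξ‖ * ‖g ξ‖ := integral_const_mul _ _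
    _ ≤ (2 * Real.pi * R * ‖v‖) * (‖m.toLp 2‖ * ‖g.toLp 2‖) := by
        gcongr
        exact integral_norm_mul_norm_le m g
    _ = _ := by ring

/-- `band m` as a linear map. -/
def bandCLM (m : 𝓢(Space d, ℝ)) : 𝓢(Space d, ℂ) →L[ℝ] 𝓢(Space d, ℝ) :=
  SchwartzMap.postcompCLM Complex.reCLM ∘L
    (FourierTransform.fourierInvCLM ℂ 𝓢(Space d, ℂ)).restrictScalars ℝ ∘L
      SchwartzMap.smulLeftCLM ℂ (m : Space d → ℝ)

/-- The gradient of `Re 𝓕⁻¹(m h)` for `h ∈ L²`, obtained by extension from Schwartz functions. -/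
def bandGrad (m : 𝓢(Space d, ℝ)) :
    L2 d ℂ →L[ℝ] Lp (α := Space d) (Space d →L[ℝ] ℝ) ∞ volume :=
  LinearMap.extendOfNorm (gradTop d ∘L bandCLM m).toLinearMap
    (SchwartzMap.toLpCLM ℝ (E := Space d) ℂ 2 volume).toLinearMap

theorem denseRange_schwartz :
    DenseRange (SchwartzMap.toLpCLM ℝ (E := Space d) ℂ 2 volume) :=
  SchwartzMap.denseRange_toLpCLM ENNReal.ofNat_ne_top

theorem norm_gradTop_band_le {m : 𝓢(Space d, ℝ)} {R : ℝ} (hm : ∀ ξ, m ξ ≠ 0 → ‖ξ‖ ≤ R)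
    (hR : 0 ≤ R) (g : 𝓢(Space d, ℂ)) :
    ‖gradTop d (band m g)‖ ≤ 2 * Real.pi * R * ‖m.toLp 2‖ * ‖g.toLp 2‖ := by
  have hpi := Real.pi_pos
  refine SchwartzMap.norm_toLp_top_le.trans ?_
  refine SchwartzMap.seminorm_le_bound ℝ 0 0 _ (by positivity) fun x => ?_
  simpa using norm_fderiv_band_le hm hR g x

theorem bandGrad_toLp {m : 𝓢(Space d, ℝ)} {R : ℝ} (hm : ∀ ξ, m ξ ≠ 0 → ‖ξ‖ ≤ R)
    (hR : 0 ≤ R) (g : 𝓢(Space d, ℂ)) : bandGrad m (g.toLp 2) = gradTop d (band m g) :=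
  LinearMap.extendOfNorm_eq (f := (gradTop d ∘L bandCLM m).toLinearMap)
    (e := (SchwartzMap.toLpCLM ℝ (E := Space d) ℂ 2 volume).toLinearMap)
    denseRange_schwartz ⟨_, norm_gradTop_band_le hm hR⟩ g

theorem norm_bandGrad_le {m : 𝓢(Space d, ℝ)} {R : ℝ} (hm : ∀ ξ, m ξ ≠ 0 → ‖ξ‖ ≤ R)
    (hR : 0 ≤ R) (h : L2 d ℂ) : ‖bandGrad m h‖ ≤ 2 * Real.pi * R * ‖m.toLp 2‖ * ‖h‖ :=
  LinearMap.norm_extendOfNorm_apply_le (f := (gradTop d ∘L bandCLM m).toLinearMap)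
    (e := (SchwartzMap.toLpCLM ℝ (E := Space d) ℂ 2 volume).toLinearMap)
    denseRange_schwartz _ (norm_gradTop_band_le hm hR) h

theorem abs_covectorPairing_le (q : Lp (α := Space d) (Space d) 1 volume)
    (L : Lp (α := Space d) (Space d →L[ℝ] ℝ) ∞ volume) :
    |covectorPairing d q L| ≤ ‖q‖ * ‖L‖ := by
  rw [covectorPairing, ContinuousLinearMap.lpPairing_eq_integral, L1.norm_eq_integral_norm,
    ← integral_mul_const, ← Real.norm_eq_abs]
  have hL : ∀ᵐ x, ‖L x‖ ≤ ‖L‖ := by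
    have := ae_le_eLpNormEssSup (f := (L : Space d → Space d →L[ℝ] ℝ)) (μ := volume)
    filter_upwards [this] with x hx
    rw [Lp.norm_def, ← toReal_enorm]
    refine ENNReal.toReal_mono (Lp.eLpNorm_ne_top L) ?_
    rwa [eLpNorm_exponent_top]
  refine norm_integral_le_of_norm_le ((L1.integrable_coeFn q).norm.mul_const _) ?_
  filter_upwards [hL] with x hx
  rw [mul_comm]
  exact (L x).le_of_opNorm_le hx (q x)

/-- The functional `h ↦ ∫ q · ∇ Re 𝓕⁻¹(m h)` on `L²(ℝ^d; ℂ)`, for an integrable vector field `q`. -/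
def drift (m : 𝓢(Space d, ℝ)) : Lp (α := Space d) (Space d) 1 volume →L[ℝ] L2 d ℂ →L[ℝ] ℝ :=
  ((covectorPairing d).flip ∘L bandGrad m).flip

theorem drift_apply (m : 𝓢(Space d, ℝ)) (q : Lp (α := Space d) (Space d) 1 volume) (h : L2 d ℂ) :
    drift m q h = covectorPairing d q (bandGrad m h) := rfl

theorem norm_drift_le {m : 𝓢(Space d, ℝ)} {R : ℝ} (hm : ∀ ξ, m ξ ≠ 0 → ‖ξ‖ ≤ R)
    (hR : 0 ≤ R) (q : Lp (α := Space d) (Space d) 1 volume) :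
    ‖drift m q‖ ≤ 2 * Real.pi * R * ‖m.toLp 2‖ * ‖q‖ := by
  have hpi := Real.pi_pos
  refine ContinuousLinearMap.opNorm_le_bound _ (by positivity) fun h => ?_
  rw [drift_apply]
  refine (abs_covectorPairing_le _ _).trans ?_
  calc ‖q‖ * ‖bandGrad m h‖ ≤ ‖q‖ * (2 * Real.pi * R * ‖m.toLp 2‖ * ‖h‖) := by
        gcongr
        exact norm_bandGrad_le hm hR h
    _ = _ := by ring

/-- A drift-diffusion identity tested on the frequency side, against arbitrary `L²` functions. -/
theorem inner_mulOp_fourierL2_of_test {m : 𝓢(Space d, ℝ)} {R : ℝ}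
    (hm : ∀ ξ, m ξ ≠ 0 → ‖ξ‖ ≤ R) (hR : 0 ≤ R)
    (f z : L2 d ℝ) (q : Lp (α := Space d) (Space d) 1 volume)
    (hf : ∀ φ : Space d → ℝ, IsTestFunction φ →
      ∫ x, f x * φ x = (∫ x, fderiv ℝ φ x (q x)) + ∫ x, z x * Laplacian.laplacian φ x)
    (h : L2 d ℂ) :
    inner ℝ (mulOp m (fourierL2 f)) h
      = drift m q h - inner ℝ (mulOp (laplacianSymbol m) (fourierL2 z)) h := by
  refine denseRange_schwartz.induction_on (p := fun h =>
    inner ℝ (mulOp m (fourierL2 f)) h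
      = drift m q h - inner ℝ (mulOp (laplacianSymbol m) (fourierL2 z)) h) h
    (isClosed_eq (by fun_prop) (by fun_prop)) fun g => ?_
  rw [SchwartzMap.toLpCLM_apply, drift_apply, bandGrad_toLp hm hR, ← inner_band, ← inner_band,
    inner_schwartz_of_test f z q hf, laplacian_band]
  have : (-band (laplacianSymbol m) g).toLp 2 volume
      = -(band (laplacianSymbol m) g).toLp 2 volume :=
    map_neg (SchwartzMap.toLpCLM ℝ (E := Space d) ℝ 2 volume) _
  rw [this, inner_neg_right, sub_eq_add_neg]

/-! ### The frequency-localized equation -/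

theorem IsAdmissibleVelocity.norm_le {α ν c : ℝ} {u : ℝ → L2 d (Space d)}
    (hu : IsAdmissibleVelocity α ν c u) (hα : 0 ≤ α) (hc : 1 ≤ c) {t : ℝ} (ht : 0 < t) :
    ‖u t‖ ≤ c := by
  refine (hu.norm_bounds t ht).2.trans ?_
  have h1 : (1 + t) ^ (-α) ≤ 1 := Real.rpow_le_one_of_one_le_of_nonpos (by linarith) (by linarith)
  nlinarith

theorem IsSolution.aestronglyMeasurable {κ : ℝ} {u : ℝ → L2 d (Space d)} {θ₀ : L2 d ℝ}
    {θ : ℝ → L2 d ℝ} (hθ : IsSolution κ u θ₀ θ) (t : ℝ) :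
    AEStronglyMeasurable θ (volume.restrict (Ioc 0 t)) :=
  (hθ.continuous.mono fun _ hs => hs.1.le).aestronglyMeasurable measurableSet_Ioc

theorem IsSolution.exists_norm_le {κ : ℝ} {u : ℝ → L2 d (Space d)} {θ₀ : L2 d ℝ}
    {θ : ℝ → L2 d ℝ} (hθ : IsSolution κ u θ₀ θ) (t : ℝ) :
    ∃ B : ℝ, 0 ≤ B ∧ ∀ s ∈ Icc 0 t, ‖θ s‖ ≤ B := by
  obtain ⟨B, hB⟩ := (isCompact_Icc (a := (0 : ℝ)) (b := t)).exists_bound_of_continuousOn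
    (hθ.continuous.mono fun _ hs => hs.1)
  exact ⟨max B 0, le_max_right _ _, fun s hs => (hB s hs).trans (le_max_left _ _)⟩

theorem IsSolution.intervalIntegrable {κ : ℝ} {u : ℝ → L2 d (Space d)} {θ₀ : L2 d ℝ}
    {θ : ℝ → L2 d ℝ} (hθ : IsSolution κ u θ₀ θ) {a b : ℝ} (ha : 0 ≤ a) (hb : 0 ≤ b) :
    IntervalIntegrable θ volume a b :=
  (hθ.continuous.mono fun _ hs => (le_min ha hb).trans hs.1).intervalIntegrable

theorem aestronglyMeasurable_flux {α ν c κ : ℝ} {u : ℝ → L2 d (Space d)} {θ₀ : L2 d ℝ}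
    {θ : ℝ → L2 d ℝ} (hu : IsAdmissibleVelocity α ν c u) (hθ : IsSolution κ u θ₀ θ) (t : ℝ) :
    AEStronglyMeasurable (fun s => flux (θ s) (u s)) (volume.restrict (Ioc 0 t)) :=
  (flux (d := d)).aestronglyMeasurable_comp₂ (hθ.aestronglyMeasurable t)
    (hu.measurable.mono_measure (Measure.restrict_mono (fun _ hs => hs.1) le_rfl))

theorem intervalIntegrable_flux {α ν c κ : ℝ} {u : ℝ → L2 d (Space d)} {θ₀ : L2 d ℝ}
    {θ : ℝ → L2 d ℝ} (hα : 0 ≤ α) (hc : 1 ≤ c) (hu : IsAdmissibleVelocity α ν c u)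
    (hθ : IsSolution κ u θ₀ θ) {t : ℝ} (ht : 0 ≤ t) :
    IntervalIntegrable (fun s => flux (θ s) (u s)) volume 0 t := by
  rw [intervalIntegrable_iff_integrableOn_Ioc_of_le ht]
  obtain ⟨B, hB0, hB⟩ := hθ.exists_norm_le t
  refine Integrable.of_bound (aestronglyMeasurable_flux hu hθ t) (B * c) ?_
  filter_upwards [ae_restrict_mem measurableSet_Ioc] with s hs
  refine (norm_flux_le _ _).trans ?_
  gcongr
  · exact hB s ⟨hs.1.le, hs.2⟩
  · exact hu.norm_le hα hc hs.1

/-- The functional driving the evolution of the frequency-localized solution: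
`d/dt ⟨m θ̂, h⟩ = ⟨θ u, ∇ Re 𝓕⁻¹(m h)⟩ - κ ⟨4π²|ξ|² m θ̂, h⟩`. -/
def bandForce (m : 𝓢(Space d, ℝ)) (κ : ℝ) (f : L2 d ℝ) (w : L2 d (Space d)) :
    L2 d ℂ →L[ℝ] ℝ :=
  drift m (flux f w) - κ • innerSL ℝ (mulOp (laplacianSymbol m) (fourierL2 f))

theorem bandForce_apply (m : 𝓢(Space d, ℝ)) (κ : ℝ) (f : L2 d ℝ) (w : L2 d (Space d))
    (h : L2 d ℂ) : bandForce m κ f w h =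
      drift m (flux f w) h - κ * inner ℝ (mulOp (laplacianSymbol m) (fourierL2 f)) h := rfl

theorem aestronglyMeasurable_bandForce {α ν c κ : ℝ} {u : ℝ → L2 d (Space d)} {θ₀ : L2 d ℝ}
    {θ : ℝ → L2 d ℝ} (m : 𝓢(Space d, ℝ)) (hu : IsAdmissibleVelocity α ν c u)
    (hθ : IsSolution κ u θ₀ θ) (t : ℝ) :
    AEStronglyMeasurable (fun s => bandForce m κ (θ s) (u s)) (volume.restrict (Ioc 0 t)) := by
  refine ((drift m).continuous.comp_aestronglyMeasurable
    (aestronglyMeasurable_flux hu hθ t)).sub (AEStronglyMeasurable.const_smul ?_ κ)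
  exact (((innerSL ℝ).continuous.comp (mulOp (laplacianSymbol m)).continuous).comp
    (fourierL2 (d := d)).continuous).comp_aestronglyMeasurable (hθ.aestronglyMeasurable t)

theorem _root_.IntervalIntegrable.clm_comp {X Y : Type*} [NormedAddCommGroup X] [NormedSpace ℝ X]
    [NormedAddCommGroup Y] [NormedSpace ℝ Y] {f : ℝ → X} {a b : ℝ}
    (hf : IntervalIntegrable f volume a b) (Λ : X →L[ℝ] Y) :
    IntervalIntegrable (fun s => Λ (f s)) volume a b :=
  ⟨Λ.integrable_comp hf.1, Λ.integrable_comp hf.2⟩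

theorem integral_test_integrand (f : L2 d ℝ) (w : L2 d (Space d)) (κ : ℝ) (φ : 𝓢(Space d, ℝ)) :
    ∫ x, f x * (fderiv ℝ φ x (w x) + κ * Laplacian.laplacian (φ : Space d → ℝ) x)
      = covectorPairing d (flux f w) (gradTop d φ)
        + κ * inner ℝ f ((Laplacian.laplacian φ : 𝓢(Space d, ℝ)).toLp 2) := by
  rw [covectorPairing_gradTop, inner_toLp_eq_integral, ← integral_const_mul, ← integral_add]
  · refine integral_congr_ae ?_
    filter_upwards [coeFn_flux f w] with x hx
    rw [hx, map_smul, smul_eq_mul, SchwartzMap.laplacian_apply]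
    ring
  · exact (ContinuousLinearMap.apply ℝ ℝ :
      Space d →L[ℝ] (Space d →L[ℝ] ℝ) →L[ℝ] ℝ).integrable_of_bilin_of_bdd_right
        (SchwartzMap.seminorm ℝ 0 0 (SchwartzMap.fderivCLM ℝ (Space d) ℝ φ))
        (L1.integrable_coeFn (flux f w))
        (SchwartzMap.fderivCLM ℝ (Space d) ℝ φ).continuous.aestronglyMeasurable
        (Eventually.of_forall fun x => SchwartzMap.norm_le_seminorm ℝ
          (SchwartzMap.fderivCLM ℝ (Space d) ℝ φ) x)
  · exact ((Lp.memLp f).integrable_mul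
      ((Laplacian.laplacian φ : 𝓢(Space d, ℝ)).memLp 2 volume)).const_mul κ

set_option maxHeartbeats 1000000 in
/-- The weak formulation with the time integral carried out in `L¹` and `L²`. -/
theorem IsSolution.integrated_equation {α ν c κ : ℝ} {u : ℝ → L2 d (Space d)} {θ₀ : L2 d ℝ}
    {θ : ℝ → L2 d ℝ} (hα : 0 ≤ α) (hc : 1 ≤ c) (hu : IsAdmissibleVelocity α ν c u)
    (hθ : IsSolution κ u θ₀ θ) {t : ℝ} (ht : 0 < t) (φ : Space d → ℝ) (hφ : IsTestFunction φ) :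
    ∫ x, (θ t - θ₀) x * φ x
      = (∫ x, fderiv ℝ φ x ((∫ s in (0 : ℝ)..t, flux (θ s) (u s)) x))
        + ∫ x, (κ • ∫ s in (0 : ℝ)..t, θ s) x * Laplacian.laplacian φ x := by
  have iq := intervalIntegrable_flux hα hc hu hθ ht.le
  have iθ := hθ.intervalIntegrable le_rfl ht.le
  obtain ⟨φ', rfl⟩ : ∃ φ' : 𝓢(Space d, ℝ), (φ' : Space d → ℝ) = φ :=
    ⟨hφ.2.toSchwartzMap hφ.1, rfl⟩
  obtain ⟨Λ₁, hΛ₁⟩ : ∃ Λ₁ : Lp (α := Space d) (Space d) 1 volume →L[ℝ] ℝ,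
      ∀ q, covectorPairing d q (gradTop d φ') = Λ₁ q :=
    ⟨(covectorPairing d).flip (gradTop d φ'), fun _ => rfl⟩
  obtain ⟨Λ₂, hΛ₂⟩ : ∃ Λ₂ : L2 d ℝ →L[ℝ] ℝ, ∀ f,
      inner ℝ f ((Laplacian.laplacian φ' : 𝓢(Space d, ℝ)).toLp 2) = Λ₂ f :=
    ⟨innerSL ℝ ((Laplacian.laplacian φ' : 𝓢(Space d, ℝ)).toLp 2), fun _ => real_inner_comm _ _⟩
  have hΔ : ∀ f : L2 d ℝ, ∫ x, f x * Laplacian.laplacian (φ' : Space d → ℝ) x = Λ₂ f := by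
    intro f
    rw [← hΛ₂, inner_toLp_eq_integral]
    simp only [SchwartzMap.laplacian_apply]
  have heq := hθ.equation φ' hφ t ht
  simp only [integral_test_integrand, hΛ₁, hΛ₂] at heq
  rw [intervalIntegral.integral_add (iq.clm_comp Λ₁) ((iθ.clm_comp Λ₂).const_mul κ),
    intervalIntegral.integral_const_mul, Λ₁.intervalIntegral_comp_comm iq,
    Λ₂.intervalIntegral_comp_comm iθ] at heq
  rw [hΔ, ← covectorPairing_gradTop, hΛ₁, ← inner_toLp_eq_integral, inner_sub_left,
    inner_toLp_eq_integral, inner_toLp_eq_integral, heq, map_smul, smul_eq_mul]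

/-- Weak solutions satisfy the frequency-localized equation in integrated form. -/
theorem inner_mulOp_sub_eq_integral {α ν c κ : ℝ} {u : ℝ → L2 d (Space d)} {θ₀ : L2 d ℝ}
    {θ : ℝ → L2 d ℝ} (hα : 0 ≤ α) (hc : 1 ≤ c) (hu : IsAdmissibleVelocity α ν c u)
    (hθ : IsSolution κ u θ₀ θ) {m : 𝓢(Space d, ℝ)} {R : ℝ}
    (hm : ∀ ξ, m ξ ≠ 0 → ‖ξ‖ ≤ R) (hR : 0 ≤ R) {t : ℝ} (ht : 0 ≤ t) (h : L2 d ℂ) :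
    inner ℝ (mulOp m (fourierL2 (θ t)) - mulOp m (fourierL2 (θ 0))) h
      = ∫ s in (0 : ℝ)..t, bandForce m κ (θ s) (u s) h := by
  rcases ht.eq_or_lt with rfl | ht'
  · simp
  have iq := intervalIntegrable_flux hα hc hu hθ ht
  have iθ := hθ.intervalIntegrable le_rfl ht
  rw [← map_sub, ← map_sub, hθ.initial, inner_mulOp_fourierL2_of_test hm hR (θ t - θ₀) _ _
    (hθ.integrated_equation hα hc hu ht') h]
  have e1 : drift m (∫ s in (0 : ℝ)..t, flux (θ s) (u s)) h
      = ∫ s in (0 : ℝ)..t, drift m (flux (θ s) (u s)) h :=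
    (((drift m).flip h).intervalIntegral_comp_comm iq).symm
  let Λ : L2 d ℝ →L[ℝ] ℝ := (innerSL ℝ h) ∘L (mulOp (laplacianSymbol m)) ∘L fourierL2
  have hΛ : ∀ f, inner ℝ (mulOp (laplacianSymbol m) (fourierL2 f)) h = Λ f :=
    fun f => real_inner_comm h (mulOp (laplacianSymbol m) (fourierL2 f))
  have i1 : IntervalIntegrable (fun s => drift m (flux (θ s) (u s)) h) volume 0 t :=
    iq.clm_comp ((drift m).flip h)
  have i2 : IntervalIntegrable (fun s => κ * Λ (θ s)) volume 0 t :=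
    (iθ.clm_comp Λ).const_mul κ
  simp only [bandForce_apply, hΛ]
  rw [map_smul, smul_eq_mul, e1, intervalIntegral.integral_sub i1 i2,
    intervalIntegral.integral_const_mul, Λ.intervalIntegral_comp_comm iθ]

/-! ### The energy inequality -/

/-- The chain rule for the square of the norm of a curve whose weak derivative is a bounded family
of functionals. -/
theorem norm_sq_sub_norm_sq_eq_integral {H : Type*} [NormedAddCommGroup H] [InnerProductSpace ℝ H]
    {W : ℝ → H} {F : ℝ → H →L[ℝ] ℝ} {T K : ℝ} (hT : 0 ≤ T) (hW : ContinuousOn W (Icc 0 T))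
    (hFm : AEStronglyMeasurable F (volume.restrict (Ioc 0 T)))
    (hFb : ∀ s ∈ Ioc 0 T, ‖F s‖ ≤ K)
    (h : ∀ t ∈ Icc 0 T, ∀ x, inner ℝ (W t - W 0) x = ∫ s in (0 : ℝ)..t, F s x) :
    ‖W T‖ ^ 2 - ‖W 0‖ ^ 2 = 2 * ∫ s in (0 : ℝ)..T, F s (W s) := by
  rcases hT.eq_or_lt with rfl | hT'
  · simp
  have hK : 0 ≤ K := (norm_nonneg _).trans (hFb T ⟨hT', le_rfl⟩)
  obtain ⟨B, hB⟩ := isCompact_Icc.exists_bound_of_continuousOn hW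
  have hint : ∀ V : ℝ → H, ContinuousOn V (Icc 0 T) →
      IntegrableOn (fun s => F s (V s)) (Ioc 0 T) := by
    intro V hV
    obtain ⟨C, hC⟩ := isCompact_Icc.exists_bound_of_continuousOn hV
    refine Integrable.of_bound ((ContinuousLinearMap.id ℝ (H →L[ℝ] ℝ)).aestronglyMeasurable_comp₂
      hFm ((hV.mono Ioc_subset_Icc_self).aestronglyMeasurable measurableSet_Ioc)) (K * C) ?_
    filter_upwards [ae_restrict_mem measurableSet_Ioc] with s hs
    exact (F s).le_of_opNorm_le_of_le (hFb s hs) (hC s (Ioc_subset_Icc_self hs))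
  have hii : ∀ V : ℝ → H, ContinuousOn V (Icc 0 T) → ∀ a ∈ Icc 0 T, ∀ b ∈ Icc 0 T, a ≤ b →
      IntervalIntegrable (fun s => F s (V s)) volume a b := by
    intro V hV a ha b hb hab
    rw [intervalIntegrable_iff_integrableOn_Ioc_of_le hab]
    exact (hint V hV).mono_set (Ioc_subset_Ioc ha.1 hb.2)
  have h0 : (0 : ℝ) ∈ Icc 0 T := ⟨le_rfl, hT⟩
  -- `E` is constant: its increment over `[a, b]` is the integral of `F s (W a + W b - 2 W s)`,
  -- which is `o(b - a)` because `W` is continuous.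
  let E : ℝ → ℝ := fun t => ‖W t‖ ^ 2 - 2 * ∫ s in (0 : ℝ)..t, F s (W s)
  have hEc : ContinuousOn E (Icc 0 T) := by
    refine (hW.norm.pow 2).sub (continuousOn_const.mul ?_)
    have := intervalIntegral.continuousOn_primitive_interval (f := fun s => F s (W s))
      (a := 0) (b := T) (μ := volume) (by
        rw [uIcc_of_le hT, integrableOn_Icc_iff_integrableOn_Ioc]
        exact hint W hW)
    rwa [uIcc_of_le hT] at this
  have hdiff : ∀ a ∈ Icc 0 T, ∀ b ∈ Icc 0 T, a ≤ b →
      E b - E a = ∫ s in a..b, F s (W a + W b - (2 : ℝ) • W s) := by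
    intro a ha b hb hab
    have e1 : ∀ x, inner ℝ (W b - W a) x = ∫ s in a..b, F s x := by
      intro x
      have hx := hii (fun _ => x) continuousOn_const
      have hadd := intervalIntegral.integral_add_adjacent_intervals (hx 0 h0 a ha ha.1)
        (hx a ha b hb hab)
      rw [← h b hb, ← h a ha] at hadd
      rw [eq_sub_iff_add_eq'.mpr hadd, ← inner_sub_left]
      congr 1
      abel
    have e2 : E b - E a = inner ℝ (W b - W a) (W a + W b) - 2 * ∫ s in a..b, F s (W s) := by
      have hs := hii W hW
      have hadd := intervalIntegral.integral_add_adjacent_intervals (hs 0 h0 a ha ha.1)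
        (hs a ha b hb hab)
      rw [eq_sub_iff_add_eq'.mpr hadd]
      simp only [E, inner_sub_left, inner_add_right, real_inner_self_eq_norm_sq]
      rw [real_inner_comm (W a) (W b)]
      ring
    rw [e2, e1, ← intervalIntegral.integral_const_mul, ← intervalIntegral.integral_sub
      (hii _ continuousOn_const a ha b hb hab) ((hii W hW a ha b hb hab).const_mul 2)]
    simp only [map_sub, map_smul, smul_eq_mul]
  have hconst := constant_of_has_deriv_right_zero hEc (fun x hx => by
    rw [hasDerivWithinAt_iff_isLittleO, Asymptotics.isLittleO_iff]
    intro ε hε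
    have hxI : x ∈ Icc 0 T := Ico_subset_Icc_self hx
    have hcont := (hW x hxI)
    rw [Metric.continuousWithinAt_iff] at hcont
    obtain ⟨δ, hδ, hcl⟩ := hcont (ε / (3 * (K + 1))) (by positivity)
    have hmem : Icc x (min T (x + δ / 2)) ∈ 𝓝[Ici x] x :=
      Icc_mem_nhdsGE (lt_min hx.2 (by linarith))
    filter_upwards [hmem] with y hy
    have hyI : y ∈ Icc 0 T := ⟨hx.1.trans hy.1, hy.2.trans (min_le_left _ _)⟩
    have hclose : ∀ s ∈ Icc x y, ‖W s - W x‖ ≤ ε / (3 * (K + 1)) := by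
      intro s hs
      rw [← dist_eq_norm]
      refine (hcl ⟨hx.1.trans hs.1, hs.2.trans hyI.2⟩ ?_).le
      rw [Real.dist_eq, abs_of_nonneg (by linarith [hs.1])]
      have := hy.2.trans (min_le_right _ _)
      linarith [hs.2]
    rw [smul_zero, sub_zero, hdiff x hxI y hyI hy.1]
    refine (intervalIntegral.norm_integral_le_of_norm_le_const (C := ε) fun s hs => ?_).trans
      (by rw [Real.norm_eq_abs])
    rw [uIoc_of_le hy.1] at hs
    have hs' : s ∈ Icc x y := Ioc_subset_Icc_self hs
    refine ((F s).le_of_opNorm_le (hFb s ⟨hx.1.trans_lt hs.1, hs.2.trans hyI.2⟩) _).trans ?_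
    have hsum : ‖W x + W y - (2 : ℝ) • W s‖ ≤ 3 * (ε / (3 * (K + 1))) := by
      have : W x + W y - (2 : ℝ) • W s = (W y - W x) - (2 : ℝ) • (W s - W x) := by
        rw [smul_sub, two_smul ℝ (W x)]; abel
      rw [this]
      refine (norm_sub_le _ _).trans ?_
      rw [norm_smul, Real.norm_two]
      linarith [hclose y ⟨hy.1, le_rfl⟩, hclose s hs']
    calc K * ‖W x + W y - (2 : ℝ) • W s‖ ≤ (K + 1) * (3 * (ε / (3 * (K + 1)))) := by
          gcongr; linarith
      _ = ε := by field_simp) T ⟨hT, le_rfl⟩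
  simp only [E, intervalIntegral.integral_same, mul_zero, sub_zero] at hconst
  linarith

/-- Taking real parts does not increase the distance to the real function `f`, so `band m g`
approximates `f` at least as well as `m g` approximates its Fourier transform. -/
theorem norm_sub_band_le (f : L2 d ℝ) (m : 𝓢(Space d, ℝ)) (g : 𝓢(Space d, ℂ)) :
    ‖f - (band m g).toLp 2 volume‖ ≤ ‖fourierL2 f - mulOp m (g.toLp 2)‖ := by
  set ψ : 𝓢(Space d, ℂ) := FourierTransformInv.fourierInv (symbolMul m g) with hψ
  have hsub : ∀ a b : L2 d ℂ, (FourierTransform.fourier (a - b) : L2 d ℂ)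
      = FourierTransform.fourier a - FourierTransform.fourier b :=
    map_sub (FourierTransform.fourierCLM ℂ (L2 d ℂ))
  have h1 : fourierL2 f - mulOp m (g.toLp 2)
      = FourierTransform.fourier (complexify f - ψ.toLp 2 volume) := by
    rw [hsub, SchwartzMap.toLp_fourier_eq, hψ,
      FourierTransform.fourier_fourierInv_eq, mulOp_toLp, fourierL2_apply]
  rw [h1, Lp.norm_fourier_eq]
  refine Lp.norm_le_norm_of_ae_le ?_
  filter_upwards [Lp.coeFn_sub f ((band m g).toLp 2 volume),
    Lp.coeFn_sub (complexify f) (ψ.toLp 2 volume),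
    coeFn_complexify f, (band m g).coeFn_toLp 2 volume, ψ.coeFn_toLp 2 volume] with x h1 h2 h3 h4 h5
  rw [h1, h2, Pi.sub_apply, Pi.sub_apply, h3, h4, h5]
  have : f x - band m g x = ((f x : ℂ) - ψ x).re := by
    rw [Complex.sub_re, Complex.ofReal_re]; rfl
  rw [this]
  exact Complex.abs_re_le_norm _

theorem norm_band_toLp_le (m : 𝓢(Space d, ℝ)) (g : 𝓢(Space d, ℂ)) :
    ‖(band m g).toLp 2 volume‖ ≤ ‖mulOp m (g.toLp 2)‖ := by
  simpa using norm_sub_band_le (0 : L2 d ℝ) m g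

/-- On the frequency side, the weak gradient bounds multiplication by `2π ⟨ξ, v⟩`. -/
theorem norm_mulOp_coordSymbol_le {f : L2 d ℝ} {G : L2 d (Space d →L[ℝ] ℝ)}
    (hG : HasWeakGradient f G) {m : 𝓢(Space d, ℝ)} (hm : ∀ ξ, ‖m ξ‖ ≤ 1) (v : Space d) :
    ‖mulOp (coordSymbol m v) (fourierL2 f)‖ ≤ ‖v‖ * ‖G‖ := by
  set Θ := mulOp (coordSymbol m v) (fourierL2 f)
  have hGv : ‖((ContinuousLinearMap.apply ℝ ℝ v).compLp G : L2 d ℝ)‖ ≤ ‖v‖ * ‖G‖ := by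
    refine ((ContinuousLinearMap.apply ℝ ℝ v).norm_compLp_le G).trans ?_
    gcongr
    exact ContinuousLinearMap.opNorm_le_bound _ (norm_nonneg _) fun L => by
      rw [mul_comm]; exact L.le_opNorm v
  have key : ∀ h : L2 d ℂ, inner ℝ Θ h ≤ ‖v‖ * ‖G‖ * ‖h‖ := by
    intro h
    refine denseRange_schwartz.induction_on (p := fun h => inner ℝ Θ h ≤ ‖v‖ * ‖G‖ * ‖h‖) h
      (isClosed_le (by fun_prop) (by fun_prop)) fun g => ?_
    have hg : Complex.I • ((-Complex.I) • g) = g := by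
      rw [smul_smul]; simp
    rw [SchwartzMap.toLpCLM_apply, ← inner_band]
    conv_lhs => rw [← hg, ← lineDeriv_band]
    rw [inner_lineDeriv_of_hasWeakGradient hG, ← inner_neg_right]
    refine (real_inner_le_norm _ _).trans ?_
    rw [norm_neg]
    refine mul_le_mul hGv ?_ (norm_nonneg _) (by positivity)
    refine (norm_band_toLp_le _ _).trans ((norm_mulOp_le_of_bound m hm _).trans ?_)
    rw [one_mul]
    have : ((-Complex.I) • g).toLp 2 volume = (-Complex.I) • g.toLp 2 volume :=
      map_smul (SchwartzMap.toLpCLM ℂ (E := Space d) ℂ 2 volume) _ _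
    rw [this, norm_smul]
    simp
  have h1 := key Θ
  rw [real_inner_self_eq_norm_sq, sq] at h1
  rcases (norm_nonneg Θ).eq_or_lt with h0 | h0
  · rw [← h0]; positivity
  · exact le_of_mul_le_mul_right h1 h0

theorem norm_toLp_fderiv_le (v : 𝓢(Space d, ℝ)) :
    ‖(SchwartzMap.fderivCLM ℝ (Space d) ℝ v).toLp 2 volume‖ ≤
      ∑ i, ‖(LineDeriv.lineDerivOp (EuclideanSpace.basisFun (Fin d) ℝ i) v :
        𝓢(Space d, ℝ)).toLp 2 volume‖ := by
  set b := EuclideanSpace.basisFun (Fin d) ℝ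
  have hpt : ∀ x, ‖fderiv ℝ v x‖ ≤
      ∑ i, ‖(LineDeriv.lineDerivOp (b i) v : 𝓢(Space d, ℝ)) x‖ := by
    intro x
    refine ContinuousLinearMap.opNorm_le_bound _ (Finset.sum_nonneg fun _ _ => norm_nonneg _)
      fun y => ?_
    conv_lhs => rw [← b.sum_repr y]
    rw [map_sum, Finset.sum_mul]
    refine (norm_sum_le _ _).trans (Finset.sum_le_sum fun i _ => ?_)
    rw [map_smul, norm_smul, SchwartzMap.lineDerivOp_apply_eq_fderiv, mul_comm]
    gcongr
    exact PiLp.norm_apply_le y i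
  simp only [SchwartzMap.norm_toLp]
  rw [← ENNReal.toReal_sum fun i _ => ((LineDeriv.lineDerivOp (b i) v :
    𝓢(Space d, ℝ)).eLpNorm_lt_top 2 volume).ne]
  refine ENNReal.toReal_mono (ENNReal.sum_ne_top.mpr fun i _ => ((LineDeriv.lineDerivOp (b i) v :
    𝓢(Space d, ℝ)).eLpNorm_lt_top 2 volume).ne) ?_
  calc eLpNorm (SchwartzMap.fderivCLM ℝ (Space d) ℝ v) 2 volume
      ≤ eLpNorm (∑ i, fun x => ‖(LineDeriv.lineDerivOp (b i) v : 𝓢(Space d, ℝ)) x‖) 2 volume := by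
        refine eLpNorm_mono_real fun x => ?_
        rw [Finset.sum_apply]
        exact hpt x
    _ ≤ ∑ i, eLpNorm (fun x => ‖(LineDeriv.lineDerivOp (b i) v : 𝓢(Space d, ℝ)) x‖) 2 volume :=
        eLpNorm_sum_le (fun i _ => (LineDeriv.lineDerivOp (b i) v :
          𝓢(Space d, ℝ)).continuous.norm.aestronglyMeasurable) (by norm_num)
    _ = _ := by simp only [eLpNorm_norm]

theorem integral_norm_mul_norm_le_norm_mul_norm {F : Type} [NormedAddCommGroup F] [NormedSpace ℝ F]
    (a : L2 d ℝ) (b : L2 d F) :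
    Integrable (fun x => ‖a x‖ * ‖b x‖) ∧ ∫ x, ‖a x‖ * ‖b x‖ ≤ ‖a‖ * ‖b‖ := by
  let B := (ContinuousLinearMap.lsmul ℝ ℝ : ℝ →L[ℝ] F →L[ℝ] F)
  have hae : (fun x => ‖(B.holder 1 a b) x‖) =ᵐ[volume] fun x => ‖a x‖ * ‖b x‖ := by
    filter_upwards [ContinuousLinearMap.coeFn_holder B (r := 1) a b] with x hx
    rw [hx]
    exact norm_smul _ _
  refine ⟨(L1.integrable_coeFn (B.holder 1 a b)).norm.congr hae, ?_⟩
  rw [← integral_congr_ae hae, ← L1.norm_eq_integral_norm]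
  refine (ContinuousLinearMap.norm_holder_apply_apply_le B a b).trans ?_
  rw [mul_assoc]
  exact mul_le_of_le_one_left (by positivity) ContinuousLinearMap.opNorm_lsmul_le

/-- `∫ v w · ∇v = 0` for divergence-free `w`, since `v ∇v = ∇(v²) / 2`. -/
theorem covectorPairing_flux_self {w : L2 d (Space d)} (hdiv : IsDivergenceFree w)
    (v : 𝓢(Space d, ℝ)) : covectorPairing d (flux (v.toLp 2) w) (gradTop d v) = 0 := by
  have h := integral_fderiv_of_isDivergenceFree hdiv (SchwartzMap.smulLeftCLM ℝ (v : Space d → ℝ) v)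
  rw [covectorPairing_gradTop]
  have h2 : ∫ x, fderiv ℝ (SchwartzMap.smulLeftCLM ℝ (v : Space d → ℝ) v) x (w x)
      = 2 * ∫ x, fderiv ℝ v x (flux (v.toLp 2) w x) := by
    rw [← integral_const_mul]
    refine integral_congr_ae ?_
    filter_upwards [coeFn_flux (v.toLp 2) w, v.coeFn_toLp 2 volume] with x h1 h2
    have hd : HasFDerivAt (SchwartzMap.smulLeftCLM ℝ (v : Space d → ℝ) v)
        (v x • fderiv ℝ v x + v x • fderiv ℝ v x) x := by
      have := (v.differentiableAt (x := x)).hasFDerivAt.mul v.differentiableAt.hasFDerivAt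
      have hv : (SchwartzMap.smulLeftCLM ℝ (v : Space d → ℝ) v : Space d → ℝ) = ⇑v * ⇑v := by
        funext y
        exact SchwartzMap.smulLeftCLM_apply_apply v.hasTemperateGrowth v y
      rw [hv]
      exact this
    rw [hd.fderiv, h1, h2, map_smul]
    simp only [add_apply, smul_apply, smul_eq_mul]
    ring
  rw [h2] at h
  linarith

/-- A Schwartz function is transported by a divergence-free field without gain of energy, so that
only the difference `f - v` contributes to the transport term. -/
theorem abs_covectorPairing_flux_le {w : L2 d (Space d)} (hdiv : IsDivergenceFree w) {K : ℝ}
    (hw : ∀ᵐ x, ‖w x‖ ≤ K) (f : L2 d ℝ) (v : 𝓢(Space d, ℝ)) :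
    |covectorPairing d (flux f w) (gradTop d v)| ≤
      K * (‖f - v.toLp 2 volume‖ *
        ‖(SchwartzMap.fderivCLM ℝ (Space d) ℝ v).toLp 2 volume‖) := by
  set D : L2 d (Space d →L[ℝ] ℝ) := (SchwartzMap.fderivCLM ℝ (Space d) ℝ v).toLp 2 volume
  have hK : 0 ≤ K := by
    obtain ⟨x, hx⟩ := hw.exists
    exact (norm_nonneg _).trans hx
  have h1 : flux f w = flux (f - v.toLp 2 volume) w + flux (v.toLp 2) w := by
    rw [map_sub]; simp
  rw [h1, map_add, add_apply, covectorPairing_flux_self hdiv, add_zero, covectorPairing_gradTop]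
  obtain ⟨hi, hle⟩ := integral_norm_mul_norm_le_norm_mul_norm (f - v.toLp 2 volume) D
  rw [← Real.norm_eq_abs]
  refine (norm_integral_le_of_norm_le (hi.const_mul K) ?_).trans ?_
  · filter_upwards [coeFn_flux (f - v.toLp 2 volume) w, hw,
      (SchwartzMap.fderivCLM ℝ (Space d) ℝ v).coeFn_toLp 2 volume] with x h1 h2 h3
    have h3' : D x = fderiv ℝ v x := h3
    rw [h1, map_smul, norm_smul, h3']
    have := (fderiv ℝ v x).le_of_opNorm_le_of_le le_rfl h2
    calc _ ≤ ‖(f - v.toLp 2 volume) x‖ * (‖fderiv ℝ v x‖ * K) := by gcongr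
      _ = _ := by ring
  · rw [integral_const_mul]
    gcongr

/-- The frequency-localized equation dissipates energy, up to the effect of the truncation. -/
theorem bandForce_self_le {f : L2 d ℝ} {G : L2 d (Space d →L[ℝ] ℝ)} (hG : HasWeakGradient f G)
    {w : L2 d (Space d)} (hdiv : IsDivergenceFree w) {K κ R : ℝ} (hw : ∀ᵐ x, ‖w x‖ ≤ K)
    (hκ : 0 ≤ κ) {m : 𝓢(Space d, ℝ)} (hm : ∀ ξ, m ξ ≠ 0 → ‖ξ‖ ≤ R) (hR : 0 ≤ R)
    (hm1 : ∀ ξ, ‖m ξ‖ ≤ 1) :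
    bandForce m κ f w (mulOp m (fourierL2 f)) ≤
      K * (‖fourierL2 f - mulOp m (mulOp m (fourierL2 f))‖ * (d * ‖G‖)) := by
  have hK : 0 ≤ K := by
    obtain ⟨x, hx⟩ := hw.exists
    exact (norm_nonneg _).trans hx
  set b := EuclideanSpace.basisFun (Fin d) ℝ
  have key : ∀ h : L2 d ℂ, drift m (flux f w) h ≤
      K * (‖fourierL2 f - mulOp m h‖ * ∑ i, ‖mulOp (coordSymbol m (b i)) h‖) := by
    intro h
    refine denseRange_schwartz.induction_on (p := fun h => drift m (flux f w) h ≤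
      K * (‖fourierL2 f - mulOp m h‖ * ∑ i, ‖mulOp (coordSymbol m (b i)) h‖)) h
      (isClosed_le (by fun_prop) (by fun_prop)) fun g => ?_
    rw [SchwartzMap.toLpCLM_apply, drift_apply, bandGrad_toLp hm hR]
    refine (le_abs_self _).trans ((abs_covectorPairing_flux_le hdiv hw f (band m g)).trans ?_)
    gcongr
    · exact norm_sub_band_le f m g
    · refine (norm_toLp_fderiv_le _).trans (Finset.sum_le_sum fun i _ => ?_)
      rw [lineDeriv_band]
      refine (norm_band_toLp_le _ _).trans (le_of_eq ?_)
      rw [mulOp_toLp, mulOp_toLp]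
      have : symbolMul (coordSymbol m (b i)) (Complex.I • g)
          = Complex.I • symbolMul (coordSymbol m (b i)) g := by
        ext ξ
        rw [smul_apply, symbolMul_apply, symbolMul_apply, smul_apply, smul_comm]
      rw [this]
      have h2 : (Complex.I • symbolMul (coordSymbol m (b i)) g).toLp 2 volume
          = Complex.I • (symbolMul (coordSymbol m (b i)) g).toLp 2 volume :=
        map_smul (SchwartzMap.toLpCLM ℂ (E := Space d) ℂ 2 volume) _ _
      rw [h2, norm_smul, Complex.norm_I, one_mul]
  have hpos : 0 ≤ inner ℝ (mulOp (laplacianSymbol m) (fourierL2 f)) (mulOp m (fourierL2 f)) := by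
    rw [L2.inner_def]
    refine integral_nonneg_of_ae ?_
    filter_upwards [coeFn_mulOp (laplacianSymbol m) (fourierL2 f),
      coeFn_mulOp m (fourierL2 f)] with ξ h1 h2
    rw [h1, h2, laplacianSymbol_apply, real_inner_smul_left, real_inner_smul_right,
      real_inner_self_eq_norm_sq]
    have : (0 : ℝ) ≤ (2 * Real.pi) ^ 2 * ‖ξ‖ ^ 2 * (m ξ) ^ 2 * ‖fourierL2 f ξ‖ ^ 2 := by
      positivity
    simp only [Pi.zero_apply]
    nlinarith
  rw [bandForce_apply]
  have h1 := key (mulOp m (fourierL2 f))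
  have h2 : ∑ i, ‖mulOp (coordSymbol m (b i)) (mulOp m (fourierL2 f))‖ ≤ d * ‖G‖ := by
    calc _ ≤ ∑ _i : Fin d, ‖G‖ := Finset.sum_le_sum fun i _ => by
          rw [mulOp_comm]
          refine (norm_mulOp_le_of_bound m hm1 _).trans ?_
          rw [one_mul]
          refine (norm_mulOp_coordSymbol_le hG hm1 (b i)).trans ?_
          rw [b.orthonormal.1 i, one_mul]
      _ = d * ‖G‖ := by simp
  have h3 := mul_nonneg hκ hpos
  have h4 : K * (‖fourierL2 f - mulOp m (mulOp m (fourierL2 f))‖ *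
      ∑ i, ‖mulOp (coordSymbol m (b i)) (mulOp m (fourierL2 f))‖) ≤
      K * (‖fourierL2 f - mulOp m (mulOp m (fourierL2 f))‖ * (d * ‖G‖)) := by gcongr
  linarith

/-! ### Sup bound for the velocity -/

open scoped Convolution in
/-- Mollification turns an essentially bounded weak gradient into a Lipschitz bound. -/
theorem norm_convolution_sub_le {F : Type} [NormedAddCommGroup F] [NormedSpace ℝ F]
    [CompleteSpace F] {w : Space d → F}
    {G : Space d → Space d →L[ℝ] F} (h : HasWeakGradient w G) {L : ℝ}
    (hG : ∀ᵐ x, ‖G x‖ ≤ L) (φ : ContDiffBump (0 : Space d)) (x y : Space d) :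
    ‖(φ.normed volume ⋆[ContinuousLinearMap.lsmul ℝ ℝ, volume] w : Space d → F) x
      - (φ.normed volume ⋆[ContinuousLinearMap.lsmul ℝ ℝ, volume] w : Space d → F) y‖
      ≤ L * ‖x - y‖ := by
  set f : Space d → ℝ := φ.normed volume with hf
  have hfc : HasCompactSupport f := φ.hasCompactSupport_normed
  have hfs : ContDiff ℝ ∞ f := φ.contDiff_normed
  have hL : 0 ≤ L := by
    obtain ⟨x, hx⟩ := hG.exists
    exact (norm_nonneg _).trans hx
  have hder : ∀ x, HasFDerivAt (f ⋆[ContinuousLinearMap.lsmul ℝ ℝ, volume] w : Space d → F)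
      ((fderiv ℝ f ⋆[(ContinuousLinearMap.lsmul ℝ ℝ : ℝ →L[ℝ] F →L[ℝ] F).precompL (Space d),
        volume] w) x) x :=
    fun x => hfc.hasFDerivAt_convolution_left _ (hfs.of_le (by exact_mod_cast le_top)) h.1 x
  refine Convex.norm_image_sub_le_of_norm_hasFDerivWithin_le (s := univ)
    (fun z _ => (hder z).hasFDerivWithinAt) (fun z _ => ?_) convex_univ (mem_univ y) (mem_univ x)
  refine ContinuousLinearMap.opNorm_le_bound _ hL fun v => ?_
  have hex : ConvolutionExistsAt (fderiv ℝ f) w z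
      ((ContinuousLinearMap.lsmul ℝ ℝ : ℝ →L[ℝ] F →L[ℝ] F).precompL (Space d)) volume :=
    (hfc.fderiv (𝕜 := ℝ)).convolutionExists_left _ (hfs.continuous_fderiv (by simp)) h.1 z
  have hψ : IsTestFunction (fun y => f (z - y)) := by
    refine ⟨hfs.comp (contDiff_const.sub contDiff_id), ?_⟩
    exact hfc.comp_homeomorph (Homeomorph.subLeft z)
  have hψd : ∀ y, fderiv ℝ (fun y => f (z - y)) y v = -fderiv ℝ f (z - y) v := by
    intro y
    have h1 : HasFDerivAt (fun y => z - y) (-ContinuousLinearMap.id ℝ (Space d)) y := by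
      simpa using (hasFDerivAt_id y).const_sub z
    have h2 := ((hfs.differentiable (by simp)) (z - y)).hasFDerivAt.comp y h1
    have h3 := h2.fderiv
    rw [Function.comp_def] at h3
    rw [h3]
    simp
  have hval : (fderiv ℝ f ⋆[(ContinuousLinearMap.lsmul ℝ ℝ : ℝ →L[ℝ] F →L[ℝ] F).precompL (Space d),
      volume] w) z v = ∫ y, f (z - y) • G y v := by
    have h1 := h.2.2 _ hψ v
    simp only [hψd, neg_smul, integral_neg, neg_inj] at h1
    rw [← h1, convolution_def, ContinuousLinearMap.integral_apply hex,
      ← integral_sub_left_eq_self _ volume z]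
    simp
  rw [hval]
  have hint : Integrable (fun y => f (z - y)) :=
    ((φ.integrable_normed (μ := volume)).comp_sub_left z)
  refine (norm_integral_le_of_norm_le (hint.mul_const (L * ‖v‖)) ?_).trans (le_of_eq ?_)
  · filter_upwards [hG] with y hy
    rw [norm_smul, Real.norm_of_nonneg (φ.nonneg_normed _)]
    exact mul_le_mul_of_nonneg_left ((G y).le_of_opNorm_le hy v) (φ.nonneg_normed _)
  · rw [integral_mul_const, integral_sub_left_eq_self (fun y => f y) volume z,
      φ.integral_normed, one_mul]

/-- A function with an essentially bounded weak gradient has a Lipschitz representative. -/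
theorem exists_ae_lipschitz {F : Type} [NormedAddCommGroup F] [NormedSpace ℝ F]
    [CompleteSpace F] {w : Space d → F}
    {G : Space d → Space d →L[ℝ] F} (h : HasWeakGradient w G) {L : ℝ}
    (hG : ∀ᵐ x, ‖G x‖ ≤ L) :
    ∃ S : Set (Space d), (∀ᵐ x, x ∈ S) ∧ ∀ x ∈ S, ∀ y ∈ S, ‖w x - w y‖ ≤ L * ‖x - y‖ := by
  let φ : ℕ → ContDiffBump (0 : Space d) := fun n =>
    ⟨1 / ((n : ℝ) + 1), 2 * (1 / ((n : ℝ) + 1)), by positivity,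
      by linarith [show (0 : ℝ) < 1 / ((n : ℝ) + 1) by positivity]⟩
  have hφ : Tendsto (fun n => (φ n).rOut) atTop (𝓝 0) := by
    have := (tendsto_one_div_add_atTop_nhds_zero_nat (𝕜 := ℝ)).const_mul 2
    rw [mul_zero] at this
    exact this
  have hae := ContDiffBump.ae_convolution_tendsto_right_of_locallyIntegrable (μ := volume) hφ
    (K := 2) (Eventually.of_forall fun n => le_rfl) h.1
  refine ⟨{x | _}, hae, fun x hx y hy => ?_⟩
  exact le_of_tendsto (Tendsto.sub hx hy).norm
    (Eventually.of_forall fun n => norm_convolution_sub_le h hG (φ n) x y)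

theorem norm_sq_eq_integral {F : Type} [NormedAddCommGroup F] [InnerProductSpace ℝ F]
    (w : L2 d F) : ‖w‖ ^ 2 = ∫ x, ‖w x‖ ^ 2 := by
  rw [← real_inner_self_eq_norm_sq, L2.inner_def]
  simp only [real_inner_self_eq_norm_sq]

/-- Interpolation between `L²` and `W^{1,∞}`: averaging the Lipschitz bound over unit balls. -/
theorem ae_norm_sq_le_of_hasWeakGradient (w : L2 d (Space d))
    {G : Space d → Space d →L[ℝ] Space d} (h : HasWeakGradient w G) {L : ℝ}
    (hG : ∀ᵐ x, ‖G x‖ ≤ L) :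
    ∀ᵐ x, ‖w x‖ ^ 2 ≤
      2 * L ^ 2 + 2 * ‖w‖ ^ 2 / volume.real (Metric.ball (0 : Space d) 1) := by
  have hL : 0 ≤ L := by
    obtain ⟨x, hx⟩ := hG.exists
    exact (norm_nonneg _).trans hx
  obtain ⟨S, hS, hlip⟩ := exists_ae_lipschitz h hG
  have hw2 : Integrable (fun y => ‖w y‖ ^ 2) := (Lp.memLp w).integrable_norm_pow (by norm_num)
  set V := volume.real (Metric.ball (0 : Space d) 1) with hV
  have hVpos : 0 < V := ENNReal.toReal_pos (Metric.measure_ball_pos _ _ one_pos).ne'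
    measure_ball_lt_top.ne
  filter_upwards [hS] with x hx
  have hVx : volume.real (Metric.ball x 1) = V := by
    rw [hV, Measure.real, Measure.real, Measure.addHaar_ball_center]
  have h1 : ∫ _y in Metric.ball x 1, ‖w x‖ ^ 2 ≤
      ∫ y in Metric.ball x 1, (2 * L ^ 2 + 2 * ‖w y‖ ^ 2) := by
    refine setIntegral_mono_on_ae (integrableOn_const measure_ball_lt_top.ne)
      ((integrableOn_const measure_ball_lt_top.ne).add (hw2.const_mul 2).integrableOn)
      measurableSet_ball ?_
    filter_upwards [hS] with y hy hyb
    have hd : ‖x - y‖ ≤ 1 := by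
      rw [← dist_eq_norm, dist_comm]; exact (Metric.mem_ball.mp hyb).le
    have h2 : ‖w x‖ ≤ L + ‖w y‖ := by
      have := hlip x hx y hy
      have h3 : L * ‖x - y‖ ≤ L := mul_le_of_le_one_right hL hd
      have h4 := norm_sub_norm_le (w x) (w y)
      linarith
    nlinarith [norm_nonneg (w x), norm_nonneg (w y), sq_nonneg (L - ‖w y‖)]
  have hc : Integrable (fun _ : Space d => 2 * L ^ 2) (volume.restrict (Metric.ball x 1)) :=
    integrableOn_const measure_ball_lt_top.ne
  rw [setIntegral_const, integral_add hc (hw2.const_mul 2).integrableOn, setIntegral_const,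
    hVx, integral_const_mul, smul_eq_mul, smul_eq_mul] at h1
  have h5 : ∫ y in Metric.ball x 1, ‖w y‖ ^ 2 ≤ ‖w‖ ^ 2 := by
    rw [norm_sq_eq_integral]
    exact setIntegral_le_integral hw2 (Eventually.of_forall fun y => by positivity)
  have h6 : 2 * L ^ 2 + 2 * ‖w‖ ^ 2 / V = (V * (2 * L ^ 2) + 2 * ‖w‖ ^ 2) / V := by
    field_simp
  rw [h6, le_div_iff₀ hVpos]
  nlinarith

theorem IsAdmissibleVelocity.exists_ae_norm_le {α ν c : ℝ} {u : ℝ → L2 d (Space d)}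
    (hu : IsAdmissibleVelocity α ν c u) (hα : 0 ≤ α) (hν : 0 ≤ ν) (hc : 1 ≤ c) :
    ∃ K : ℝ, 0 ≤ K ∧ ∀ t, 0 < t → ∀ᵐ x, ‖u t x‖ ≤ K := by
  refine ⟨Real.sqrt (2 * c ^ 2 + 2 * c ^ 2 / volume.real (Metric.ball (0 : Space d) 1)),
    Real.sqrt_nonneg _, fun t ht => ?_⟩
  obtain ⟨G, hG, -, hGle⟩ := hu.gradient_bounds t ht
  have hrpow : c * (1 + t) ^ (-ν) ≤ c := by
    have h1 : (1 + t) ^ (-ν) ≤ 1 :=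
      Real.rpow_le_one_of_one_le_of_nonpos (by linarith) (by linarith)
    nlinarith
  have hGae : ∀ᵐ x, ‖G x‖ ≤ c := by
    rw [eLpNorm_exponent_top] at hGle
    filter_upwards [ae_le_eLpNormEssSup (f := G) (μ := volume)] with x hx
    have := (hx.trans hGle).trans (ENNReal.ofReal_le_ofReal hrpow)
    rwa [← ofReal_norm, ENNReal.ofReal_le_ofReal_iff (by linarith)] at this
  filter_upwards [ae_norm_sq_le_of_hasWeakGradient (u t) hG hGae] with x hx
  refine Real.le_sqrt_of_sq_le (hx.trans ?_)
  have hut := hu.norm_le hα hc ht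
  gcongr

/-! ### Frequency truncation and monotonicity of the L² norm -/

theorem norm_laplacianSymbol_le {m : 𝓢(Space d, ℝ)} {R : ℝ} (hm : ∀ ξ, m ξ ≠ 0 → ‖ξ‖ ≤ R)
    (ξ : Space d) : ‖laplacianSymbol m ξ‖ ≤ (2 * Real.pi * R) ^ 2 * ‖m ξ‖ := by
  rw [laplacianSymbol_apply, norm_mul]
  by_cases h0 : m ξ = 0
  · simp [h0]
  · rw [Real.norm_of_nonneg (by positivity), ← mul_pow]
    have := hm ξ h0
    have hpi := Real.pi_pos
    gcongr

/-- For frequencies below `R`, advection costs a factor `R` and diffusion a factor `κ R²`. -/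
theorem norm_bandForce_le {m : 𝓢(Space d, ℝ)} {R : ℝ} (hm : ∀ ξ, m ξ ≠ 0 → ‖ξ‖ ≤ R)
    (hR : 0 ≤ R) {κ : ℝ} (hκ : 0 ≤ κ) (f : L2 d ℝ) (w : L2 d (Space d)) :
    ‖bandForce m κ f w‖ ≤ 2 * Real.pi * R * ‖m.toLp 2 volume‖ * (‖f‖ * ‖w‖)
      + κ * (2 * Real.pi * R) ^ 2 * ‖mulOp m (fourierL2 f)‖ := by
  have hpi := Real.pi_pos
  refine (norm_sub_le _ _).trans (add_le_add ?_ ?_)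
  · refine (norm_drift_le hm hR _).trans ?_
    gcongr
    exact norm_flux_le f w
  · rw [norm_smul, Real.norm_of_nonneg hκ, innerSL_apply_norm, mul_assoc]
    gcongr
    exact norm_mulOp_le _ _ (norm_laplacianSymbol_le hm) _

/-- A smooth bump function as a Schwartz symbol. -/
def cutoff (χ : ContDiffBump (0 : Space d)) : 𝓢(Space d, ℝ) :=
  χ.hasCompactSupport.toSchwartzMap χ.contDiff

theorem cutoff_apply (χ : ContDiffBump (0 : Space d)) (ξ : Space d) : cutoff χ ξ = χ ξ := rfl

theorem norm_cutoff_le_one (χ : ContDiffBump (0 : Space d)) (ξ : Space d) : ‖cutoff χ ξ‖ ≤ 1 := by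
  rw [cutoff_apply, Real.norm_of_nonneg χ.nonneg]
  exact χ.le_one

theorem norm_le_of_cutoff_ne_zero (χ : ContDiffBump (0 : Space d)) (ξ : Space d)
    (h : cutoff χ ξ ≠ 0) : ‖ξ‖ ≤ χ.rOut := by
  by_contra hc
  exact h (χ.zero_of_le_dist (by rw [dist_zero_right]; exact (not_le.mp hc).le))

theorem tendsto_mulOp_cutoff {χ : ℕ → ContDiffBump (0 : Space d)}
    (hχ : Tendsto (fun n => (χ n).rIn) atTop atTop) (h : L2 d ℂ) :
    Tendsto (fun n => ‖h - mulOp (cutoff (χ n)) h‖) atTop (𝓝 0) := by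
  have hsq : ∀ n, ‖h - mulOp (cutoff (χ n)) h‖ ^ 2 =
      ∫ ξ, (1 - cutoff (χ n) ξ) ^ 2 * ‖h ξ‖ ^ 2 := by
    intro n
    rw [norm_sq_eq_integral]
    refine integral_congr_ae ?_
    filter_upwards [Lp.coeFn_sub h (mulOp (cutoff (χ n)) h),
      coeFn_mulOp (cutoff (χ n)) h] with ξ h1 h2
    rw [h1, Pi.sub_apply, h2]
    have : h ξ - cutoff (χ n) ξ • h ξ = (1 - cutoff (χ n) ξ) • h ξ := by
      rw [sub_smul, one_smul]
    rw [this, norm_smul, mul_pow, Real.norm_eq_abs, sq_abs]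
  have hlim : Tendsto (fun n => ‖h - mulOp (cutoff (χ n)) h‖ ^ 2) atTop (𝓝 0) := by
    simp only [hsq]
    have h2 : Integrable (fun ξ => ‖h ξ‖ ^ 2) := (Lp.memLp h).integrable_norm_pow (by norm_num)
    have h0 : (0 : ℝ) = ∫ _ξ : Space d, (0 : ℝ) := by simp
    rw [h0]
    refine tendsto_integral_of_dominated_convergence (fun ξ => ‖h ξ‖ ^ 2)
      (fun n => ?_) h2 (fun n => Eventually.of_forall fun ξ => ?_)
      (Eventually.of_forall fun ξ => ?_)
    · exact ((continuous_const.sub (cutoff (χ n)).continuous).pow 2).aestronglyMeasurable.mul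
        h2.aestronglyMeasurable
    · rw [Real.norm_of_nonneg (by positivity)]
      refine mul_le_of_le_one_left (by positivity) ?_
      have h3 := (χ n).nonneg (x := ξ)
      have h4 := (χ n).le_one (x := ξ)
      rw [cutoff_apply]
      nlinarith
    · refine tendsto_const_nhds.congr' ?_
      filter_upwards [hχ.eventually_ge_atTop ‖ξ‖] with n hn
      rw [cutoff_apply, (χ n).one_of_mem_closedBall (by simpa using hn)]
      simp
  have := hlim.sqrt
  simpa [Real.sqrt_sq] using this

theorem norm_sub_mulOp_mulOp_le {m : 𝓢(Space d, ℝ)} (hm : ∀ ξ, ‖m ξ‖ ≤ 1) (h : L2 d ℂ) :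
    ‖h - mulOp m (mulOp m h)‖ ≤ 2 * ‖h - mulOp m h‖ := by
  have h1 : h - mulOp m (mulOp m h) = (h - mulOp m h) + mulOp m (h - mulOp m h) := by
    rw [map_sub]; abel
  rw [h1]
  refine (norm_add_le _ _).trans ?_
  have := norm_mulOp_le_of_bound m hm (h - mulOp m h)
  linarith

theorem continuousOn_mulOp_fourierL2 {κ : ℝ} {u : ℝ → L2 d (Space d)} {θ₀ : L2 d ℝ}
    {θ : ℝ → L2 d ℝ} (hθ : IsSolution κ u θ₀ θ) (m : 𝓢(Space d, ℝ)) (t : ℝ) :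
    ContinuousOn (fun s => mulOp m (fourierL2 (θ s))) (Icc 0 t) :=
  ((mulOp m).continuous.comp (fourierL2 (d := d)).continuous).comp_continuousOn
    (hθ.continuous.mono fun _ hs => hs.1)

/-- The energy inequality for a frequency truncation, with the commutator error explicit. -/
theorem norm_sq_mulOp_le {α ν c κ K t B : ℝ} {u : ℝ → L2 d (Space d)} {θ₀ : L2 d ℝ}
    {θ : ℝ → L2 d ℝ} {g : ℝ → L2 d (Space d →L[ℝ] ℝ)} (hα : 0 ≤ α) (hc : 1 ≤ c) (hκ : 0 ≤ κ)
    (hu : IsAdmissibleVelocity α ν c u) (hθ : IsSolution κ u θ₀ θ)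
    (huK : ∀ t, 0 < t → ∀ᵐ x, ‖u t x‖ ≤ K) (ht : 0 ≤ t) (hB : ∀ s ∈ Icc 0 t, ‖θ s‖ ≤ B)
    (hg2 : MemLp g 2 (volume.restrict (Ioc 0 t)))
    (hg : ∀ᵐ s ∂(volume.restrict (Ioc 0 t)), HasWeakGradient (θ s) (g s))
    {m : 𝓢(Space d, ℝ)} {R : ℝ}
    (hm : ∀ ξ, m ξ ≠ 0 → ‖ξ‖ ≤ R) (hR : 0 ≤ R) (hm1 : ∀ ξ, ‖m ξ‖ ≤ 1) :
    ‖mulOp m (fourierL2 (θ t))‖ ^ 2 ≤ ‖θ 0‖ ^ 2 + 2 * ∫ s in (0 : ℝ)..t,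
      K * (2 * ‖fourierL2 (θ s) - mulOp m (fourierL2 (θ s))‖ * (d * ‖g s‖)) := by
  have hpi := Real.pi_pos
  have hB0 : 0 ≤ B := (norm_nonneg _).trans (hB 0 ⟨le_rfl, ht⟩)
  have hK0 : 0 ≤ K := by
    obtain ⟨x, hx⟩ := (huK 1 one_pos).exists
    exact (norm_nonneg _).trans hx
  have hm' := norm_mulOp_le_of_bound m hm1
  simp only [one_mul] at hm'
  have hWc := continuousOn_mulOp_fourierL2 hθ m t
  have hFb : ∀ s ∈ Ioc 0 t, ‖bandForce m κ (θ s) (u s)‖ ≤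
      2 * Real.pi * R * ‖m.toLp 2 volume‖ * (B * c) + κ * (2 * Real.pi * R) ^ 2 * B := by
    intro s hs
    have h1 := hB s (Ioc_subset_Icc_self hs)
    have h2 := hu.norm_le hα hc hs.1
    have h3 : ‖mulOp m (fourierL2 (θ s))‖ ≤ B :=
      (hm' _).trans ((norm_fourierL2 _).le.trans h1)
    refine (norm_bandForce_le hm hR hκ _ _).trans ?_
    gcongr
  have hFm := aestronglyMeasurable_bandForce m hu hθ t
  have hE := norm_sq_sub_norm_sq_eq_integral ht hWc hFm hFb
    (fun s hs x => inner_mulOp_sub_eq_integral hα hc hu hθ hm hR hs.1 x)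
  have hi1 : IntegrableOn (fun s => bandForce m κ (θ s) (u s) (mulOp m (fourierL2 (θ s))))
      (Ioc 0 t) := by
    refine Integrable.of_bound
      ((ContinuousLinearMap.id ℝ (L2 d ℂ →L[ℝ] ℝ)).aestronglyMeasurable_comp₂
        hFm ((hWc.mono Ioc_subset_Icc_self).aestronglyMeasurable measurableSet_Ioc))
      ((2 * Real.pi * R * ‖m.toLp 2 volume‖ * (B * c) + κ * (2 * Real.pi * R) ^ 2 * B) * B) ?_
    filter_upwards [ae_restrict_mem measurableSet_Ioc] with s hs
    exact ContinuousLinearMap.le_of_opNorm_le_of_le _ (hFb s hs) ((hm' _).trans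
      ((norm_fourierL2 _).le.trans (hB s (Ioc_subset_Icc_self hs))))
  have hgi : Integrable (fun s => ‖g s‖) (volume.restrict (Ioc 0 t)) :=
    (hg2.integrable (by norm_num)).norm
  have hi2 : IntegrableOn (fun s => K * (2 * ‖fourierL2 (θ s) - mulOp m (fourierL2 (θ s))‖ *
      (d * ‖g s‖))) (Ioc 0 t) := by
    have hΘm : AEStronglyMeasurable (fun s => fourierL2 (θ s)) (volume.restrict (Ioc 0 t)) :=
      (fourierL2 (d := d)).continuous.comp_aestronglyMeasurable (hθ.aestronglyMeasurable t)
    refine Integrable.mono' (hgi.const_mul (K * (4 * B * d))) ?_ ?_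
    · exact (((hΘm.sub ((mulOp m).continuous.comp_aestronglyMeasurable hΘm)).norm.const_mul 2).mul
        (hgi.aestronglyMeasurable.const_mul _)).const_mul _
    · filter_upwards [ae_restrict_mem measurableSet_Ioc] with s hs
      have h1 := hB s (Ioc_subset_Icc_self hs)
      have h2 : ‖fourierL2 (θ s) - mulOp m (fourierL2 (θ s))‖ ≤ 2 * B := by
        refine (norm_sub_le _ _).trans ?_
        have := hm' (fourierL2 (θ s))
        rw [norm_fourierL2] at this ⊢
        linarith
      rw [Real.norm_of_nonneg (by positivity)]
      calc _ ≤ K * (2 * (2 * B) * (d * ‖g s‖)) := by gcongr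
        _ = _ := by ring
  have hmono : ∫ s in (0 : ℝ)..t, bandForce m κ (θ s) (u s) (mulOp m (fourierL2 (θ s))) ≤
      ∫ s in (0 : ℝ)..t,
        K * (2 * ‖fourierL2 (θ s) - mulOp m (fourierL2 (θ s))‖ * (d * ‖g s‖)) := by
    rw [intervalIntegral.integral_of_le ht, intervalIntegral.integral_of_le ht]
    refine integral_mono_ae hi1 hi2 ?_
    filter_upwards [hg, ae_restrict_mem measurableSet_Ioc] with s hs hst
    refine (bandForce_self_le hs (hu.divergence_free s hst.1) (huK s hst.1) hκ hm hR hm1).trans ?_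
    gcongr
    exact norm_sub_mulOp_mulOp_le hm1 _
  have h0 : ‖mulOp m (fourierL2 (θ 0))‖ ^ 2 ≤ ‖θ 0‖ ^ 2 := by
    gcongr
    exact (hm' _).trans (norm_fourierL2 _).le
  linarith

set_option maxHeartbeats 1000000 in
/-- The `L²` norm of a weak solution does not increase. -/
theorem IsSolution.norm_le {α ν c κ : ℝ} {u : ℝ → L2 d (Space d)} {θ₀ : L2 d ℝ}
    {θ : ℝ → L2 d ℝ} (hα : 0 ≤ α) (hν : 0 ≤ ν) (hc : 1 ≤ c) (hκ : 0 ≤ κ)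
    (hu : IsAdmissibleVelocity α ν c u) (hθ : IsSolution κ u θ₀ θ) {t : ℝ} (ht : 0 < t) :
    ‖θ t‖ ≤ ‖θ₀‖ := by
  obtain ⟨g, hg2, hg⟩ := hθ.gradient
  obtain ⟨K, hK0, huK⟩ := hu.exists_ae_norm_le hα hν hc
  obtain ⟨B, hB0, hB⟩ := hθ.exists_norm_le t
  have hg2t := hg2 t ht
  have hgt : ∀ᵐ s ∂(volume.restrict (Ioc 0 t)), HasWeakGradient (θ s) (g s) :=
    ae_mono (Measure.restrict_mono (fun _ hs => hs.1) le_rfl) hg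
  let χ : ℕ → ContDiffBump (0 : Space d) := fun n => ⟨n + 1, n + 2, by positivity, by linarith⟩
  have hχ : Tendsto (fun n => (χ n).rIn) atTop atTop :=
    tendsto_atTop_add_const_right _ _ tendsto_natCast_atTop_atTop
  have hn := fun n => norm_sq_mulOp_le hα hc hκ hu hθ huK ht.le hB hg2t hgt
    (norm_le_of_cutoff_ne_zero (χ n)) (χ n).rOut_pos.le (norm_cutoff_le_one (χ n))
  have hm' : ∀ n (h : L2 d ℂ), ‖mulOp (cutoff (χ n)) h‖ ≤ ‖h‖ := fun n h => by
    simpa using norm_mulOp_le_of_bound _ (norm_cutoff_le_one (χ n)) h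
  have hgi : Integrable (fun s => ‖g s‖) (volume.restrict (Ioc 0 t)) :=
    (hg2t.integrable (by norm_num)).norm
  have hΘm : AEStronglyMeasurable (fun s => fourierL2 (θ s)) (volume.restrict (Ioc 0 t)) :=
    (fourierL2 (d := d)).continuous.comp_aestronglyMeasurable (hθ.aestronglyMeasurable t)
  have hlim : Tendsto (fun n => ∫ s in (0 : ℝ)..t, K * (2 * ‖fourierL2 (θ s) -
      mulOp (cutoff (χ n)) (fourierL2 (θ s))‖ * (d * ‖g s‖))) atTop (𝓝 0) := by
    simp only [intervalIntegral.integral_of_le ht.le]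
    suffices hs : Tendsto (fun n => ∫ s in Ioc 0 t, K * (2 * ‖fourierL2 (θ s) -
        mulOp (cutoff (χ n)) (fourierL2 (θ s))‖ * (d * ‖g s‖))) atTop
        (𝓝 (∫ s in Ioc 0 t, K * (2 * 0 * (d * ‖g s‖)))) by
      simpa using hs
    refine tendsto_integral_of_dominated_convergence (fun s => K * (4 * B * d) * ‖g s‖)
      (fun n => ?_) (hgi.const_mul _) (fun n => ?_) (Eventually.of_forall fun s => ?_)
    · have hWm := (mulOp (cutoff (χ n))).continuous.comp_aestronglyMeasurable hΘm
      exact (((hΘm.sub hWm).norm.const_mul 2).mul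
        (hgi.aestronglyMeasurable.const_mul _)).const_mul _
    · filter_upwards [ae_restrict_mem measurableSet_Ioc] with s hs
      have h1 := hB s (Ioc_subset_Icc_self hs)
      have h2 : ‖fourierL2 (θ s) - mulOp (cutoff (χ n)) (fourierL2 (θ s))‖ ≤ 2 * B := by
        refine (norm_sub_le _ _).trans ?_
        have := hm' n (fourierL2 (θ s))
        rw [norm_fourierL2] at this ⊢
        linarith
      rw [Real.norm_of_nonneg (by positivity)]
      calc _ ≤ K * (2 * (2 * B) * (d * ‖g s‖)) := by gcongr
        _ = _ := by ring
    · exact (((tendsto_mulOp_cutoff hχ (fourierL2 (θ s))).const_mul 2).mul_const _).const_mul K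
  have hleft : Tendsto (fun n => ‖mulOp (cutoff (χ n)) (fourierL2 (θ t))‖ ^ 2) atTop
      (𝓝 (‖θ t‖ ^ 2)) := by
    rw [← norm_fourierL2 (θ t)]
    refine (Tendsto.norm ?_).pow 2
    rw [tendsto_iff_norm_sub_tendsto_zero]
    exact (tendsto_mulOp_cutoff hχ (fourierL2 (θ t))).congr fun n => norm_sub_rev _ _
  have hfin := le_of_tendsto_of_tendsto hleft ((hlim.const_mul 2).const_add (‖θ 0‖ ^ 2))
    (Eventually.of_forall hn)
  rw [mul_zero, add_zero, hθ.initial] at hfin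
  exact le_of_sq_le_sq hfin (norm_nonneg _)

/-! ### Low frequencies -/

theorem norm_toLp_sq_le {m : 𝓢(Space d, ℝ)} {R : ℝ} (hm : ∀ ξ, m ξ ≠ 0 → ‖ξ‖ ≤ R)
    (hR : 0 ≤ R) (hm1 : ∀ ξ, ‖m ξ‖ ≤ 1) :
    ‖m.toLp 2 volume‖ ^ 2 ≤ R ^ d * volume.real (Metric.ball (0 : Space d) 1) := by
  have hvol : volume.real (Metric.closedBall (0 : Space d) R)
      = R ^ d * volume.real (Metric.ball (0 : Space d) 1) := by
    simpa using Measure.addHaar_real_closedBall (volume : Measure (Space d)) 0 hR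
  rw [norm_sq_eq_integral, ← hvol,
    ← integral_indicator_one Metric.isClosed_closedBall.measurableSet]
  refine integral_mono_ae ((Lp.memLp _).integrable_norm_pow (by norm_num))
    ((integrableOn_const (C := (1 : ℝ)) measure_closedBall_lt_top.ne).integrable_indicator
      Metric.isClosed_closedBall.measurableSet) ?_
  filter_upwards [m.coeFn_toLp 2 volume] with ξ hξ
  rw [hξ]
  by_cases h : m ξ = 0
  · simp only [h, norm_zero]
    exact (by norm_num : (0 : ℝ) ^ 2 = 0).trans_le
      (indicator_nonneg (fun _ _ => zero_le_one) ξ)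
  · rw [indicator_of_mem (by simpa using hm ξ h)]
    exact pow_le_one₀ (norm_nonneg _) (hm1 ξ)

theorem fourierHat_eq (f : L2 d ℝ) (ξ : Space d) :
    fourierHat f ξ = fourierL2 f ((2 * Real.pi)⁻¹ • ξ) := rfl

/-- The energy below frequency `δ` is seen by every multiplier equal to one there. -/
theorem lowFreqEnergy_le {m : 𝓢(Space d, ℝ)} {δ : ℝ} (hδ : 0 ≤ δ)
    (hm : ∀ ξ : Space d, ‖ξ‖ ≤ (2 * Real.pi)⁻¹ * δ → m ξ = 1) (f : L2 d ℝ) :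
    lowFreqEnergy f δ ≤ (2 * Real.pi) ^ d * ‖mulOp m (fourierL2 f)‖ ^ 2 := by
  have hpi := Real.pi_pos
  have h1 : lowFreqEnergy f δ = (2 * Real.pi) ^ d *
      ∫ ξ in Metric.closedBall (0 : Space d) ((2 * Real.pi)⁻¹ * δ), ‖fourierL2 f ξ‖ ^ 2 := by
    have := Measure.setIntegral_comp_smul (volume : Measure (Space d))
      (fun ξ => ‖fourierL2 f ξ‖ ^ 2) (Metric.closedBall (0 : Space d) δ)
      (R := (2 * Real.pi)⁻¹) (by positivity)
    rw [smul_closedBall _ _ hδ, smul_zero, finrank_euclideanSpace_fin,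
      Real.norm_of_nonneg (by positivity), abs_of_nonneg (by positivity), inv_pow, inv_inv,
      smul_eq_mul] at this
    exact this
  rw [h1, norm_sq_eq_integral]
  gcongr
  have h2 : ∫ ξ in Metric.closedBall (0 : Space d) ((2 * Real.pi)⁻¹ * δ), ‖fourierL2 f ξ‖ ^ 2 =
      ∫ ξ in Metric.closedBall (0 : Space d) ((2 * Real.pi)⁻¹ * δ),
        ‖mulOp m (fourierL2 f) ξ‖ ^ 2 := by
    refine setIntegral_congr_ae Metric.isClosed_closedBall.measurableSet ?_
    filter_upwards [coeFn_mulOp m (fourierL2 f)] with ξ hξ hmem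
    rw [hξ, hm ξ (by simpa using hmem), one_smul]
  rw [h2]
  exact setIntegral_le_integral ((Lp.memLp _).integrable_norm_pow (by norm_num))
    (Eventually.of_forall fun ξ => by positivity)

/-- A frequency-localized piece of `f` bounds `‖∇⁻¹ f‖₂` from below. -/
theorem ofReal_norm_mulOp_le_invGradNorm {m : 𝓢(Space d, ℝ)} {R : ℝ}
    (hm : ∀ ξ, m ξ ≠ 0 → ‖ξ‖ ≤ R) (hR : 0 < R) (hm1 : ∀ ξ, ‖m ξ‖ ≤ 1) (f : L2 d ℝ)
    (hd : 0 < d) :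
    ENNReal.ofReal ((2 * Real.pi * R)⁻¹ * ‖mulOp m (fourierL2 f)‖) ≤ invGradNorm f := by
  have hpi := Real.pi_pos
  have hpi1 : 1 ≤ 2 * Real.pi := by linarith [Real.pi_gt_three]
  have hne : (2 * Real.pi)⁻¹ ≠ 0 := by positivity
  have hmap := Measure.map_addHaar_smul (volume : Measure (Space d)) hne
  set D : Space d → Space d := fun ξ => (2 * Real.pi)⁻¹ • ξ with hD
  have hDm : Measurable D := measurable_const_smul _
  have hscale : eLpNorm (mulOp m (fourierL2 f)) 2 volume ≤
      eLpNorm (fun ξ => mulOp m (fourierL2 f) (D ξ)) 2 volume := by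
    have hle : (volume : Measure (Space d)) ≤ Measure.map D volume := by
      rw [hmap]
      refine Measure.le_iff.mpr fun s _ => ?_
      rw [Measure.smul_apply, smul_eq_mul]
      refine le_mul_of_one_le_left' ?_
      rw [← ENNReal.ofReal_one]
      refine ENNReal.ofReal_le_ofReal ?_
      rw [inv_pow, inv_inv, abs_of_nonneg (by positivity)]
      exact one_le_pow₀ hpi1
    refine (eLpNorm_mono_measure _ hle).trans (le_of_eq ?_)
    refine eLpNorm_map_measure ?_ hDm.aemeasurable
    rw [hmap]
    exact (Lp.aestronglyMeasurable _).smul_measure _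
  have hpt : ∀ᵐ ξ : Space d, ‖mulOp m (fourierL2 f) (D ξ)‖ ≤
      2 * Real.pi * R * ‖‖ξ‖⁻¹ * ‖fourierHat f ξ‖‖ := by
    have : Nonempty (Fin d) := ⟨⟨0, hd⟩⟩
    have h0 : ∀ᵐ ξ : Space d, ξ ≠ 0 := by
      simp [ae_iff]
    filter_upwards [(Measure.quasiMeasurePreserving_smul volume hne).ae
      (coeFn_mulOp m (fourierL2 f)), h0] with ξ h1 h2
    have hξ : 0 < ‖ξ‖ := norm_pos_iff.mpr h2
    rw [hD, h1, norm_smul, norm_mul, norm_inv, norm_norm, norm_norm, fourierHat_eq, ← mul_assoc]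
    gcongr
    by_cases h3 : m ((2 * Real.pi)⁻¹ • ξ) = 0
    · rw [h3, norm_zero]; positivity
    · refine (hm1 _).trans ?_
      have h4 := hm _ h3
      rw [norm_smul, Real.norm_of_nonneg (by positivity), inv_mul_le_iff₀ (by positivity)] at h4
      rw [← div_eq_mul_inv, le_div_iff₀ hξ, one_mul]
      exact h4
  have hfin := hscale.trans (eLpNorm_le_mul_eLpNorm_of_ae_le_mul hpt 2)
  rw [ENNReal.ofReal_mul (by positivity), ENNReal.ofReal_inv_of_pos (by positivity), mul_comm,
    ← div_eq_mul_inv]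
  refine ENNReal.div_le_of_le_mul ?_
  rw [mul_comm, Lp.norm_def, ENNReal.ofReal_toReal (Lp.eLpNorm_ne_top _)]
  exact hfin

theorem integral_one_add_rpow_le {β τ t : ℝ} (hβ : β < 1) (hτ : 0 ≤ τ) (hτt : τ ≤ t) :
    ∫ s in (0 : ℝ)..τ, (1 + s) ^ (-β) ≤ (1 + t) ^ (1 - β) / (1 - β) := by
  rw [intervalIntegral.integral_comp_add_left (fun s => s ^ (-β)) 1,
    integral_rpow (Or.inl (by linarith)), neg_add_eq_sub]
  have h1 : (1 + τ) ^ (1 - β) ≤ (1 + t) ^ (1 - β) :=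
    Real.rpow_le_rpow (by linarith) (by linarith) (by linarith)
  have h2 : (0 : ℝ) ≤ (1 + 0) ^ (1 - β) := by positivity
  have h3 : 0 < 1 - β := by linarith
  gcongr
  linarith

set_option maxHeartbeats 1000000 in
/-- The low frequencies of a weak solution change slowly: an a priori bound `N` on them over
`[0, t]` controls their deviation from the initial datum. -/
theorem norm_mulOp_sub_le {α β ν c κ t N : ℝ} {u : ℝ → L2 d (Space d)} {θ₀ : L2 d ℝ}
    {θ : ℝ → L2 d ℝ} (hα : 0 ≤ α) (hβα : β ≤ α) (hβ : β < 1) (hν : 0 ≤ ν) (hc : 1 ≤ c)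
    (hκ : 0 ≤ κ) (hu : IsAdmissibleVelocity α ν c u) (hθ : IsSolution κ u θ₀ θ)
    {m : 𝓢(Space d, ℝ)} {R : ℝ} (hm : ∀ ξ, m ξ ≠ 0 → ‖ξ‖ ≤ R) (hR : 0 ≤ R)
    (hN : ∀ s ∈ Icc 0 t, ‖mulOp m (fourierL2 (θ s))‖ ≤ N) {τ : ℝ} (hτ : τ ∈ Icc 0 t) :
    ‖mulOp m (fourierL2 (θ τ)) - mulOp m (fourierL2 (θ 0))‖ ≤
      2 * Real.pi * R * ‖m.toLp 2 volume‖ * (‖θ₀‖ * c) * ((1 + t) ^ (1 - β) / (1 - β))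
        + κ * (2 * Real.pi * R) ^ 2 * N * t := by
  have hpi := Real.pi_pos
  have hN0 : 0 ≤ N := (norm_nonneg _).trans (hN τ hτ)
  obtain ⟨h, hh⟩ : ∃ h, h = mulOp m (fourierL2 (θ τ)) - mulOp m (fourierL2 (θ 0)) := ⟨_, rfl⟩
  obtain ⟨A, hA⟩ : ∃ A, A = 2 * Real.pi * R * ‖m.toLp 2 volume‖ * (‖θ₀‖ * c) := ⟨_, rfl⟩
  obtain ⟨E, hE⟩ : ∃ E, E = κ * (2 * Real.pi * R) ^ 2 * N := ⟨_, rfl⟩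
  have hA0 : 0 ≤ A := by rw [hA]; positivity
  have hE0 : 0 ≤ E := by rw [hE]; positivity
  have hF : ∀ s ∈ Ioc 0 τ, ‖bandForce m κ (θ s) (u s)‖ ≤ A * (1 + s) ^ (-β) + E := by
    intro s hs
    have h1 := hθ.norm_le hα hν hc hκ hu hs.1
    have h2 : ‖u s‖ ≤ c * (1 + s) ^ (-β) := by
      refine (hu.norm_bounds s hs.1).2.trans ?_
      gcongr
      linarith [hs.1]
    have h3 := hN s ⟨hs.1.le, hs.2.trans hτ.2⟩
    refine (norm_bandForce_le hm hR hκ _ _).trans ?_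
    rw [hA, hE, mul_assoc (2 * Real.pi * R * ‖m.toLp 2 volume‖), mul_assoc ‖θ₀‖]
    gcongr
  have hint : IntervalIntegrable (fun s : ℝ => (1 + s) ^ (-β)) volume 0 τ := by
    refine ContinuousOn.intervalIntegrable fun s hs => ?_
    rw [uIcc_of_le hτ.1] at hs
    exact ((continuousAt_const.add continuousAt_id).rpow_const
      (Or.inl (by linarith [hs.1] : (0 : ℝ) < 1 + s).ne')).continuousWithinAt
  have hkey : ‖h‖ * ‖h‖ ≤ (A * ((1 + t) ^ (1 - β) / (1 - β)) + E * t) * ‖h‖ := by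
    rw [← real_inner_self_eq_norm_mul_norm]
    nth_rewrite 1 [hh]
    rw [inner_mulOp_sub_eq_integral hα hc hu hθ hm hR hτ.1 h]
    refine (le_abs_self _).trans ?_
    refine (intervalIntegral.norm_integral_le_of_norm_le hτ.1
      (g := fun s => (A * (1 + s) ^ (-β) + E) * ‖h‖) (ae_of_all _ fun s hs =>
        (ContinuousLinearMap.le_of_opNorm_le _ (hF s hs) h))
      (((hint.const_mul A).add intervalIntegrable_const).mul_const _)).trans ?_
    rw [intervalIntegral.integral_mul_const,
      intervalIntegral.integral_add (hint.const_mul A) intervalIntegrable_const,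
      intervalIntegral.integral_const_mul, intervalIntegral.integral_const, smul_eq_mul, sub_zero,
      mul_comm τ]
    have h4 := integral_one_add_rpow_le hβ hτ.1 hτ.2
    have h5 := hτ.2
    gcongr
  rw [← hh, ← hA, ← hE]
  rcases (norm_nonneg h).eq_or_lt with h0 | h0
  · rw [← h0]
    have h6 : 0 < 1 - β := by linarith
    have h7 : 0 ≤ t := hτ.1.trans hτ.2
    positivity
  · exact le_of_mul_le_mul_right hkey h0

/-- If diffusion is weak on the support of `m` up to time `t`, the low frequencies at time `t` are
comparable to the initial ones, up to the contribution of the advection. -/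
theorem two_mul_norm_mulOp_le {α β ν c κ t D : ℝ} {u : ℝ → L2 d (Space d)} {θ₀ : L2 d ℝ}
    {θ : ℝ → L2 d ℝ} (hα : 0 ≤ α) (hβα : β ≤ α) (hβ : β < 1) (hν : 0 ≤ ν) (hc : 1 ≤ c)
    (hκ : 0 ≤ κ) (hu : IsAdmissibleVelocity α ν c u) (hθ : IsSolution κ u θ₀ θ)
    {m : 𝓢(Space d, ℝ)} {R : ℝ} (hm : ∀ ξ, m ξ ≠ 0 → ‖ξ‖ ≤ R) (hR : 0 ≤ R) (ht : 0 ≤ t)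
    (hsmall : κ * (2 * Real.pi * R) ^ 2 * t ≤ 1 / 4)
    (hD : 2 * Real.pi * R * ‖m.toLp 2 volume‖ * (‖θ₀‖ * c) * ((1 + t) ^ (1 - β) / (1 - β)) ≤ D) :
    2 * ‖mulOp m (fourierL2 θ₀)‖ ≤ 3 * ‖mulOp m (fourierL2 (θ t))‖ + 4 * D := by
  -- The maximum over `[0, t]`, attained at `σ`, bounds itself with factor `1 / 4`.
  obtain ⟨σ, hσ, hmax⟩ := isCompact_Icc.exists_isMaxOn ⟨0, left_mem_Icc.mpr ht⟩
    (continuousOn_mulOp_fourierL2 hθ m t).norm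
  have hN := fun τ (hτ : τ ∈ Icc 0 t) =>
    norm_mulOp_sub_le hα hβα hβ hν hc hκ hu hθ hm hR (fun s hs => hmax hs) hτ
  have h1 := hN σ hσ
  have h2 := hN t (right_mem_Icc.mpr ht)
  rw [hθ.initial] at h1 h2
  have h3 := norm_sub_norm_le (mulOp m (fourierL2 (θ σ))) (mulOp m (fourierL2 θ₀))
  have h4 := norm_sub_norm_le (mulOp m (fourierL2 θ₀)) (mulOp m (fourierL2 (θ t)))
  rw [norm_sub_rev] at h4
  have h5 : κ * (2 * Real.pi * R) ^ 2 * ‖mulOp m (fourierL2 (θ σ))‖ * t ≤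
      1 / 4 * ‖mulOp m (fourierL2 (θ σ))‖ := by
    calc _ = κ * (2 * Real.pi * R) ^ 2 * t * ‖mulOp m (fourierL2 (θ σ))‖ := by ring
      _ ≤ _ := by gcongr
  linarith

/-! ### The lower bound -/

/-- The low-frequency comparison at scale `δ`: if `δ` is below `ρ`, diffusion is negligible at
frequencies of size `δ` up to time `t`, and advection contributes at most a quarter of the initial
low-frequency mass, then `‖∇⁻¹ θ(t)‖₂` is bounded below by a multiple of `δ ^ (r + d/2 - 1)`. -/
theorem ofReal_le_invGradNorm_of_scale {α β ν c κ t r p ρ δ : ℝ} {u : ℝ → L2 d (Space d)}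
    {θ₀ : L2 d ℝ} {θ : ℝ → L2 d ℝ} (hd : 0 < d) (hα : 0 ≤ α) (hβα : β ≤ α) (hβ : β < 1)
    (hν : 0 ≤ ν) (hc : 1 ≤ c) (hκ : 0 ≤ κ) (hp : 0 < p) (hu : IsAdmissibleVelocity α ν c u)
    (hθ : IsSolution κ u θ₀ θ) (hlow : LowFreqBounds θ₀ r p ρ) (ht : 0 ≤ t) (hδ : 0 < δ)
    (hδρ : δ ≤ ρ) (hsmall : κ * (2 * δ) ^ 2 * t ≤ 1 / 4)
    (hadv : 2 * √(volume.real (Metric.ball (0 : Space d) 1)) * (‖θ₀‖ * c) / (1 - β)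
      * δ ^ (1 + (d : ℝ) / 2) * (1 + t) ^ (1 - β)
      ≤ √(((2 * Real.pi) ^ d)⁻¹ * p⁻¹) / 4 * δ ^ (r + (d : ℝ) / 2)) :
    ENNReal.ofReal (√(((2 * Real.pi) ^ d)⁻¹ * p⁻¹) / 6 * δ ^ (r + (d : ℝ) / 2 - 1))
      ≤ invGradNorm (θ t) := by
  have hpi := Real.pi_pos
  have hpi3 := Real.pi_gt_three
  obtain ⟨V, hV⟩ : ∃ V, V = volume.real (Metric.ball (0 : Space d) 1) := ⟨_, rfl⟩
  obtain ⟨b, hb⟩ : ∃ b, b = √(((2 * Real.pi) ^ d)⁻¹ * p⁻¹) := ⟨_, rfl⟩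
  rw [← hV, ← hb] at hadv
  rw [← hb]
  have hV0 : 0 ≤ V := hV ▸ measureReal_nonneg
  have hpow : (δ ^ (r + (d : ℝ) / 2)) ^ 2 = δ ^ (2 * r + (d : ℝ)) := by
    rw [← Real.rpow_natCast, ← Real.rpow_mul hδ.le]
    congr 1
    push_cast
    ring
  let χ : ContDiffBump (0 : Space d) := ⟨(2 * Real.pi)⁻¹ * δ, δ / Real.pi, by positivity, by
    rw [inv_mul_eq_div, div_lt_div_iff₀ (by positivity) hpi]
    nlinarith [mul_pos hδ hpi]⟩
  have hR : 2 * Real.pi * χ.rOut = 2 * δ := by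
    change 2 * Real.pi * (δ / Real.pi) = _
    field_simp
  have hRδ : χ.rOut ≤ δ := by
    change δ / Real.pi ≤ δ
    rw [div_le_iff₀ hpi]
    nlinarith
  have hm := norm_le_of_cutoff_ne_zero χ
  have hm1 := norm_cutoff_le_one χ
  have hmnorm : ‖(cutoff χ).toLp 2 volume‖ ≤ √V * δ ^ ((d : ℝ) / 2) := by
    refine le_of_sq_le_sq ((norm_toLp_sq_le hm χ.rOut_pos.le hm1).trans ?_) (by positivity)
    rw [← hV, mul_pow, Real.sq_sqrt hV0, ← Real.rpow_natCast (δ ^ _), ← Real.rpow_mul hδ.le,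
      mul_comm]
    have : (d : ℝ) / 2 * (2 : ℕ) = d := by push_cast; ring
    rw [this, Real.rpow_natCast]
    have h0 := χ.rOut_pos.le
    gcongr
  have hW0 : b * δ ^ (r + (d : ℝ) / 2) ≤ ‖mulOp (cutoff χ) (fourierL2 θ₀)‖ := by
    refine le_of_sq_le_sq ?_ (norm_nonneg _)
    rw [mul_pow, hb, Real.sq_sqrt (by positivity), hpow, mul_assoc,
      inv_mul_le_iff₀ (by positivity)]
    refine (hlow δ hδ hδρ).1.trans (lowFreqEnergy_le hδ.le (fun ξ hξ => ?_) θ₀)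
    rw [cutoff_apply]
    exact χ.one_of_mem_closedBall (mem_closedBall_zero_iff.mpr hξ)
  have hD : 2 * Real.pi * χ.rOut * ‖(cutoff χ).toLp 2 volume‖ * (‖θ₀‖ * c)
      * ((1 + t) ^ (1 - β) / (1 - β)) ≤ b / 4 * δ ^ (r + (d : ℝ) / 2) := by
    have h1 : 0 < 1 - β := by linarith
    rw [hR]
    calc _ ≤ 2 * δ * (√V * δ ^ ((d : ℝ) / 2)) * (‖θ₀‖ * c) * ((1 + t) ^ (1 - β) / (1 - β)) := by
          gcongr
      _ = 2 * √V * (‖θ₀‖ * c) / (1 - β) * δ ^ (1 + (d : ℝ) / 2) * (1 + t) ^ (1 - β) := by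
          rw [Real.rpow_add hδ, Real.rpow_one]
          ring
      _ ≤ _ := hadv
  have hfin := two_mul_norm_mulOp_le hα hβα hβ hν hc hκ hu hθ hm χ.rOut_pos.le ht
    (by rw [hR]; exact hsmall) hD
  refine (ENNReal.ofReal_le_ofReal ?_).trans
    (ofReal_norm_mulOp_le_invGradNorm hm χ.rOut_pos hm1 (θ t) hd)
  rw [hR, Real.rpow_sub_one hδ.ne', le_inv_mul_iff₀ (by positivity)]
  have h2 : 2 * δ * (b / 6 * (δ ^ (r + (d : ℝ) / 2) / δ)) = b * δ ^ (r + (d : ℝ) / 2) / 3 := by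
    field_simp
    ring
  rw [h2]
  linarith

/-- The diffusive rate `‖∇⁻¹ θ(t)‖₂ ≳ (1 + t) ^ (1/2 - d/4 - r/2)`, uniform in `κ ≤ κmax`. -/
theorem exists_ofReal_le_invGradNorm (hd : 0 < d) {α r c p ρ κmax : ℝ} (M₀ : ℝ) (hα : 0 ≤ α)
    (hr : r < 1) (hrα : r / 2 + 1 / 2 < α) (hp : 0 < p) (hρ : 0 < ρ) (hc : 1 ≤ c) :
    ∃ b : ℝ, 0 < b ∧ ∀ θ₀ : L2 d ℝ, LowFreqBounds θ₀ r p ρ → ‖θ₀‖ = M₀ →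
      ∀ (ν : ℝ) (u : ℝ → L2 d (Space d)), 0 ≤ ν → IsAdmissibleVelocity α ν c u →
      ∀ (κ : ℝ) (θ : ℝ → L2 d ℝ), 0 ≤ κ → κ ≤ κmax → IsSolution κ u θ₀ θ →
      ∀ t : ℝ, 0 ≤ t →
        ENNReal.ofReal (b * (1 + t) ^ (-(d : ℝ) / 4 - r / 2 + 1 / 2)) ≤ invGradNorm (θ t) := by
  have hpi := Real.pi_pos
  set β := r / 2 + 1 / 2 with hβ
  set a := √(((2 * Real.pi) ^ d)⁻¹ * p⁻¹) with ha
  have ha0 : 0 < a := Real.sqrt_pos.mpr (by positivity)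
  set A := 2 * √(volume.real (Metric.ball (0 : Space d) 1)) * (M₀ * c) / (1 - β) with hA
  -- At scale `δ = ε (1 + t) ^ (-1/2)` both perturbations are small once `ε` is.
  obtain ⟨ε, ⟨⟨hε1, hε2⟩, hε3⟩, hε0⟩ : ∃ ε : ℝ,
      ((A * ε ^ (1 - r) < a / 4 ∧ ε < ρ) ∧ κmax * (2 * ε) ^ 2 < 1 / 4) ∧ 0 < ε := by
    have h1 : Tendsto (fun ε : ℝ => A * ε ^ (1 - r)) (𝓝[>] 0) (𝓝 0) := by
      have : ContinuousAt (fun ε : ℝ => A * ε ^ (1 - r)) 0 :=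
        continuousAt_const.mul (continuousAt_id.rpow_const (Or.inr (by linarith)))
      have h := this.tendsto
      simp only [Real.zero_rpow (by linarith : 1 - r ≠ 0), mul_zero] at h
      exact h.mono_left nhdsWithin_le_nhds
    have h2 : Tendsto (fun ε : ℝ => κmax * (2 * ε) ^ 2) (𝓝[>] 0) (𝓝 0) := by
      have : Continuous (fun ε : ℝ => κmax * (2 * ε) ^ 2) := by fun_prop
      have h := this.tendsto 0
      simp only [mul_zero, ne_eq, OfNat.ofNat_ne_zero, not_false_eq_true, zero_pow] at h
      exact h.mono_left nhdsWithin_le_nhds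
    have h3 : Tendsto (fun ε : ℝ => ε) (𝓝[>] 0) (𝓝 0) := nhdsWithin_le_nhds
    exact ((((h1.eventually_lt_const (by positivity)).and (h3.eventually_lt_const hρ)).and
      (h2.eventually_lt_const (by norm_num))).and self_mem_nhdsWithin).exists
  refine ⟨a / 6 * ε ^ (r + (d : ℝ) / 2 - 1), by positivity, ?_⟩
  intro θ₀ hlow hM ν u hν hu κ θ hκ hκmax hθ t ht
  have ht1 : 0 < 1 + t := by linarith
  have hscale : ∀ e : ℝ, (ε * (1 + t) ^ (-(1 / 2) : ℝ)) ^ e = ε ^ e * (1 + t) ^ (-(e / 2)) := by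
    intro e
    rw [Real.mul_rpow hε0.le (by positivity), ← Real.rpow_mul ht1.le]
    congr 2
    ring
  set δ := ε * (1 + t) ^ (-(1 / 2) : ℝ) with hδ
  have hδ0 : 0 < δ := by positivity
  have hδε : δ ≤ ε := by
    rw [hδ]
    exact mul_le_of_le_one_right hε0.le
      (Real.rpow_le_one_of_one_le_of_nonpos (by linarith) (by norm_num))
  have hδ2 : δ ^ 2 * (1 + t) = ε ^ 2 := by
    have := hscale (2 : ℕ)
    rw [Real.rpow_natCast, Real.rpow_natCast] at this
    rw [this, mul_assoc]
    norm_num [Real.rpow_neg_one]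
    rw [inv_mul_cancel₀ ht1.ne', mul_one]
  have key := ofReal_le_invGradNorm_of_scale (β := β) (δ := δ) hd hα hrα.le (by linarith) hν hc hκ hp
    hu hθ hlow ht hδ0 (hδε.trans hε2.le) ?_ ?_
  · convert key using 2
    rw [hscale, ← ha, mul_assoc]
    congr 3
    ring
  · calc κ * (2 * δ) ^ 2 * t ≤ κ * (2 * δ) ^ 2 * (1 + t) := by gcongr; linarith
      _ = κ * (2 * ε) ^ 2 := by linear_combination 4 * κ * hδ2
      _ ≤ κmax * (2 * ε) ^ 2 := by gcongr
      _ ≤ 1 / 4 := hε3.le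
  · have h1 : δ ^ (1 + (d : ℝ) / 2) * (1 + t) ^ (1 - β) = δ ^ (r + (d : ℝ) / 2) * ε ^ (1 - r) := by
      have h2 : 1 + (d : ℝ) / 2 = (r + (d : ℝ) / 2) + (1 - r) := by ring
      have h3 : (1 + t) ^ (-((1 - r) / 2)) * (1 + t) ^ (1 - β) = 1 := by
        rw [← Real.rpow_add ht1, hβ]
        ring_nf
        exact Real.rpow_zero _
      rw [h2, Real.rpow_add hδ0, hscale (1 - r)]
      linear_combination (δ ^ (r + (d : ℝ) / 2) * ε ^ (1 - r)) * h3
    rw [hM, ← hA, ← ha, mul_assoc, h1]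
    calc A * (δ ^ (r + (d : ℝ) / 2) * ε ^ (1 - r))
        = A * ε ^ (1 - r) * δ ^ (r + (d : ℝ) / 2) := by ring
      _ ≤ _ := by gcongr

/-- The exponential factor for `ν < 1` absorbs a full power of `1 + t`. -/
theorem exp_mul_one_add_le_one {ν t : ℝ} (hν : ν < 1) (ht : 0 < t) :
    Real.exp (-(((1 + t) ^ (-ν + 1) - 1) / (-ν + 1))) * (1 + t) ≤ 1 := by
  have ha : 0 < -ν + 1 := by linarith
  have ht1 : 0 < 1 + t := by linarith
  have h1 : Real.log (1 + t) ≤ ((1 + t) ^ (-ν + 1) - 1) / (-ν + 1) := by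
    rw [le_div_iff₀ ha, Real.rpow_def_of_pos ht1]
    linarith [Real.add_one_le_exp (Real.log (1 + t) * (-ν + 1))]
  rw [Real.exp_neg, inv_mul_le_iff₀ (Real.exp_pos _), mul_one]
  calc 1 + t = Real.exp (Real.log (1 + t)) := (Real.exp_log ht1).symm
    _ ≤ _ := Real.exp_le_exp.mpr h1

theorem exp_le_one_of_one_lt {ν t : ℝ} (hν : 1 < ν) (ht : 0 < t) :
    Real.exp (-(((1 + t) ^ (-ν + 1) - 1) / (-ν + 1))) ≤ 1 := by
  rw [Real.exp_le_one_iff, neg_nonpos]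
  refine div_nonneg_of_nonpos ?_ (by linarith)
  linarith [Real.rpow_le_one_of_one_le_of_nonpos (by linarith : 1 ≤ 1 + t)
    (by linarith : -ν + 1 ≤ 0)]

end AdvectionDiffusion

end

theorem theorem2 (d : ℕ) (hd : d = 2 ∨ d = 3) (α : ℝ) :
    -- the rational number `m` depends on `d` and `α` only
    ∃ m : ℚ, (d : ℝ) + 2 ≤ (m : ℝ) ∧
      ∀ r : ℝ, 1 - (d : ℝ) / 2 < r → r < 1 → r / 2 + 1 / 2 < α →
      -- the constant `C` depends on `d, α, r`, on `‖θ₀‖₂ = M₀`, `‖∇θ₀‖₂ = M₁`, on the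
      -- low-frequency bounds `(p, ρ)` of `θ₀`, on the factor `c` in `∼`, and on an upper bound
      -- `κmax` of the diffusivity; it does not depend on `κ`, `ν`, `t`
      ∀ M₀ M₁ p ρ c κmax : ℝ, 0 < p → 0 < ρ → 1 ≤ c → 0 < κmax →
      ∃ C : ℝ, 0 < C ∧
        ∀ (θ₀ : AdvectionDiffusion.L2 d ℝ)
          (g₀ : AdvectionDiffusion.L2 d (AdvectionDiffusion.Space d →L[ℝ] ℝ)),
          AdvectionDiffusion.HasDecayCharacter θ₀ r →
          AdvectionDiffusion.LowFreqBounds θ₀ r p ρ →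
          AdvectionDiffusion.HasWeakGradient θ₀ g₀ →
          ‖θ₀‖ = M₀ → ‖g₀‖ = M₁ →
        ∀ (ν : ℝ) (u : ℝ → AdvectionDiffusion.L2 d (AdvectionDiffusion.Space d)),
          AdvectionDiffusion.IsAdmissibleVelocity α ν c u →
        ∀ (κ : ℝ) (θ : ℝ → AdvectionDiffusion.L2 d ℝ), 0 < κ → κ ≤ κmax →
          AdvectionDiffusion.IsSolution κ u θ₀ θ →
        ∀ t : ℝ, 0 < t → AdvectionDiffusion.IsLargeTime d r α m κ t →
          (1 < ν →
            ENNReal.ofReal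
                (C * κ ^ (-(d : ℝ) / 2 - r + m + 1 / 2)
                  * Real.exp (-(((1 + t) ^ (-ν + 1) - 1) / (-ν + 1)))
                  * (1 + t) ^ (-(d : ℝ) / 4 - r / 2 + 1 / 2))
              ≤ AdvectionDiffusion.invGradNorm (θ t)) ∧
          (ν = 1 →
            ENNReal.ofReal
                (C * κ ^ (-(d : ℝ) / 2 - r + m + 1 / 2)
                  * (1 + t) ^ (-(d : ℝ) / 4 - r / 2 + 1 / 2))
              ≤ AdvectionDiffusion.invGradNorm (θ t)) ∧
          (0 ≤ ν → ν < 1 →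
            ENNReal.ofReal
                (C * κ ^ (-(d : ℝ) / 2 - r + m + 1 / 2)
                  * Real.exp (-(((1 + t) ^ (-ν + 1) - 1) / (-ν + 1)))
                  * (1 + t) ^ (-(d : ℝ) / 4 - r / 2 + 3 / 2))
              ≤ AdvectionDiffusion.invGradNorm (θ t)) := by
  have hd0 : 0 < d := by omega
  have hd3 : (d : ℝ) ≤ 3 := by exact_mod_cast (by omega : d ≤ 3)
  refine ⟨(d : ℚ) + 2, by push_cast; exact le_rfl, ?_⟩
  intro r hr hr1 hrα M₀ M₁ p ρ c κmax hp hρ hc hκmax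
  obtain ⟨b, hb, hlower⟩ := AdvectionDiffusion.exists_ofReal_le_invGradNorm (κmax := κmax) hd0 M₀
    (by linarith) hr1 hrα hp hρ hc
  push_cast
  have he : 0 ≤ -(d : ℝ) / 2 - r + (d + 2) + 1 / 2 := by
    have : (0 : ℝ) ≤ d := d.cast_nonneg
    linarith
  obtain ⟨e, hedef⟩ : ∃ e, e = -(d : ℝ) / 2 - r + (d + 2) + 1 / 2 := ⟨_, rfl⟩
  rw [← hedef] at he ⊢
  refine ⟨b / κmax ^ e, by positivity, ?_⟩
  intro θ₀ g₀ _ hlow _ hM _ ν u hu κ θ hκ hκm hθ t ht _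
  have ht1 : 0 < 1 + t := by linarith
  have hCb : b / κmax ^ e * κ ^ e ≤ b := by
    rw [div_mul_eq_mul_div]
    exact div_le_of_le_mul₀ (by positivity) hb.le (by gcongr)
  have hC0 : 0 ≤ b / κmax ^ e * κ ^ e := by positivity
  have hmain := fun hν => hlower θ₀ hlow hM ν u hν hu κ θ hκ.le hκm hθ t ht.le
  refine ⟨fun hν => ?_, fun hν => ?_, fun hν hν1 => ?_⟩
  · refine (ENNReal.ofReal_le_ofReal ?_).trans (hmain (by linarith))
    gcongr
    exact (mul_le_of_le_one_right hC0
      (AdvectionDiffusion.exp_le_one_of_one_lt hν ht)).trans hCb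
  · refine (ENNReal.ofReal_le_ofReal ?_).trans (hmain (by linarith))
    gcongr
  · refine (ENNReal.ofReal_le_ofReal ?_).trans (hmain hν)
    have hsplit : (1 + t) ^ (-(d : ℝ) / 4 - r / 2 + 3 / 2)
        = (1 + t) * (1 + t) ^ (-(d : ℝ) / 4 - r / 2 + 1 / 2) := by
      rw [← Real.rpow_one_add' ht1.le]
      · congr 1
        ring
      · linarith
    rw [hsplit, ← mul_assoc, mul_assoc (b / κmax ^ e * κ ^ e)]
    gcongr
    exact (mul_le_of_le_one_right hC0
      (AdvectionDiffusion.exp_mul_one_add_le_one hν1 ht)).trans hCb
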